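/- **Conventions.** A Boolean function is a map $f\colon\{0,1\}^n\to\{0,1\}$ with $n\ge 1$; $\Omega$ is the class of all Boolean functions. $\{0,1\}$ is ordered by $0<1$, and tuples and functions of equal arity are ordered pointwise; $\mathbf 0=(0,\dots,0)$, $\mathbf 1=(1,\dots,1)$, and $\overline{\mathbf a}$ is the componentwise complement of $\mathbf a$. For classes $C,K\subseteq\Omega$, $CK$ is the class of all compositions $f(g_1,\dots,g_n)$ with $f\in C$ $n$-ary and $g_1,\dots,g_n\in K$ all of the same arity. $K$ is a $(C_1,C_2)$-clonoid if $KC_1\subseteq K$ and $C_2K\subseteq K$. Let $\mathsf{I}_c$ be the class of all projections. Let $\mathsf{MU}^k_{01}$ be the class of all monotone $f$ with $f(\mathbf 0)=0$, $f(\mathbf 1)=1$ such that $\bigwedge T\ne\mathbf 0$ for every set $T$ of at most $k$ true points of $f$ (points with value $1$). **Classes.** For $C\subseteq \Omega$ and $a,b\in\{0,1\}$: $C_{a*}=\{f\in C: f(\mathbf 0)=a\}$, $C_{*b}=\{f\in C: f(\mathbf 1)=b\}$, $C_{ab}=C_{a*}\cap C_{*b}$, and $\overline C=\{\neg f: f\in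 C\}$. Put $T_{ab}=\Omega_{ab}$. Let $\Omega_=$, $\Omega_\le$, $\Omega_\ge$ be the classes of all $f$ with $f(\mathbf 0)=f(\mathbf 1)$, $f(\mathbf 0)\le f(\mathbf 1)$, $f(\mathbf 0)\ge f(\mathbf 1)$, respectively. $\mathsf C$, $\mathsf C_0$, $\mathsf C_1$ are the classes of constant, constant $0$, and constant $1$ functions; $\mathsf M$ is the class of monotone functions; $\mathsf R$ is the class of reflexive functions ($f(\mathbf a)=f(\overline{\mathbf a})$ for all $\mathbf a$). Write $\mathsf M_0=\mathsf M_{0*}$ and $\mathsf M_1=\mathsf M_{*1}$. **Orders.** $f$ is a minorant of $g$ if they have the same arity and $f\le g$. An $n$-ary $f$ is a minor of an $m$-ary $g$ if $f(\mathbf a)=g(\mathbf a\circ\sigma)$ for some $\sigma\colon\{1,\dots,m\}\to\{1,\dots,n\}$ and all $\mathbf a$. The minorant-minor quasiorder $\preceq$ is the transitive closure of the union of the minorant and minor relations. For $C\in\{\Omega_{*1},\Omega_{1*},\mathsf M,\overline{\mathsf M},\mathsf R\}$, $g^C$ denotes the least majorant of $g$ in $C$, and $\preceq_C$ is the transitive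 closure of the union of the minorant relation, the minor relation and $\{(g^C,g): g\in\Omega\}$. Let $\Omega^{[\le k]}$ be the class of functions with at most $k$ true points. $\mathcal I_k$ (resp. $\mathcal I_k^C$) is the set of all $\Theta\subseteq\Omega^{[\le k]}$ that are downward closed in $\Omega^{[\le k]}$ with respect to $\preceq$ (resp. $\preceq_C$), including $\emptyset$. For $\Theta\subseteq\Omega$, $U^k(\Theta)$ is the class of all $f$ such that for every set $T$ of at most $k$ true points of $f$ there are $\theta\in\Theta$ and a map $\tau$ from the index set of the arguments of $\theta$ to that of $f$ with $\theta(\mathbf a\circ\tau)=1$ for all $\mathbf a\in T$. **Theorem.** Let $k\ge 2$ be an integer. The $(\mathsf{I}_c,\mathsf{MU}^k_{01})$-clonoids are precisely the following classes: (a) $U^k(\Theta)$ for $\Theta\in\mathcal I_k$; (b) $U^k(\Theta)\cap(T_{01}\cup\mathsf C_0)$ and $U^k(\Theta)\cap T_{01}$ for nonempty $\Theta\in\mathcal I_k^{\Omega_{*1}}$; (c) $U^k(\Theta)\cap(T_{10}\cup\mathsf C_0)$ and $U^k(\Theta)\cap T_{10}$ for nonempty $\Theta\in\mathcal I_k^{\Omega_{1*}}$;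 (d) $U^k(\Theta)\cap\mathsf M_{0}$ and $U^k(\Theta)\cap\mathsf M_{01}$ for nonempty $\Theta\in\mathcal I_k^{\mathsf M}$; (e) $U^k(\Theta)\cap\overline{\mathsf M_{1}}$ and $U^k(\Theta)\cap\overline{\mathsf M_{01}}$ for nonempty $\Theta\in\mathcal I_k^{\overline{\mathsf M}}$; (f) $U^k(\Theta)\cap\mathsf R_{00}$ for nonempty $\Theta\in\mathcal I_k^{\mathsf R}$; (g) the 26 classes $\Omega_\le$, $\Omega_\ge$, $\Omega_=$, $\Omega_{0*}\cup\mathsf C$, $\Omega_{*0}\cup\mathsf C$, $\Omega_{1*}\cup\mathsf C$, $\Omega_{*1}\cup\mathsf C$, $\Omega_{00}\cup\mathsf C$, $\Omega_{01}\cup\mathsf C$, $\Omega_{10}\cup\mathsf C$, $\Omega_{11}\cup\mathsf C$, $\Omega_{01}\cup\mathsf C_1$, $\Omega_{10}\cup\mathsf C_1$, $\Omega_{1*}$, $\Omega_{*1}$, $\Omega_{11}$, $\mathsf M$, $\mathsf M_{1}$, $\overline{\mathsf M}$, $\overline{\mathsf M_{0}}$, $\mathsf R$, $\mathsf R_{00}\cup\mathsf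 C$, $\mathsf R_{11}\cup\mathsf C$, $\mathsf R_{11}$, $\mathsf C$, $\mathsf C_1$. -/

import Mathlib

namespace NUMinions

/-- `n`-ary Boolean functions. `Bool` is ordered by `false < true`, tuples and functions are
ordered pointwise; `⊥` and `⊤` are the constant tuples `(0, …, 0)` and `(1, …, 1)`. -/
abbrev BF (n : ℕ+) : Type := (Fin n → Bool) → Bool

/-- Boolean functions of arbitrary positive arity. -/
structure BoolFun where
  arity : ℕ+
  val : BF arity

/-! ### Composition, clonoids -/

/-- The composition `C K` of function classes: all `f (g₁, …, gₙ)` with `f ∈ C` of arity `n` and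
`g₁, …, gₙ ∈ K` of one and the same arity `m`. -/
def compClass (C K : Set BoolFun) : Set BoolFun :=
  {h | ∃ (m n : ℕ+) (f : BF n) (g : Fin n → BF m),
    (⟨n, f⟩ : BoolFun) ∈ C ∧ (∀ i, (⟨m, g i⟩ : BoolFun) ∈ K) ∧
      h = ⟨m, fun a => f fun i => g i a⟩}

/-- `K` is a `(C₁, C₂)`-clonoid. -/
def IsClonoid (C₁ C₂ K : Set BoolFun) : Prop :=
  compClass K C₁ ⊆ K ∧ compClass C₂ K ⊆ K

/-! ### Classes of Boolean functions -/

/-- The functions in `C` with `f (0, …, 0) = a`. -/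
def at0 (C : Set BoolFun) (a : Bool) : Set BoolFun := {f | f ∈ C ∧ f.val ⊥ = a}

/-- The functions in `C` with `f (1, …, 1) = b`. -/
def at1 (C : Set BoolFun) (b : Bool) : Set BoolFun := {f | f ∈ C ∧ f.val ⊤ = b}

/-- The functions in `C` with `f (0, …, 0) = a` and `f (1, …, 1) = b`. -/
def at01 (C : Set BoolFun) (a b : Bool) : Set BoolFun := at0 C a ∩ at1 C b

/-- The class of all Boolean functions. -/
def All : Set BoolFun := Set.univ

/-- All functions with `f (0, …, 0) = a` and `f (1, …, 1) = b`. -/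
def Om (a b : Bool) : Set BoolFun := at01 All a b

/-- All functions with `f (0, …, 0) = f (1, …, 1)`. -/
def OmEq : Set BoolFun := {f | f.val ⊥ = f.val ⊤}

/-- All functions with `f (0, …, 0) ≤ f (1, …, 1)`. -/
def OmLe : Set BoolFun := {f | f.val ⊥ ≤ f.val ⊤}

/-- All functions with `f (0, …, 0) ≥ f (1, …, 1)`. -/
def OmGe : Set BoolFun := {f | f.val ⊤ ≤ f.val ⊥}

/-- The constant functions. -/
def Const : Set BoolFun := {f | ∀ a b, f.val a = f.val b}

/-- The constant functions with value `0`. -/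
def Const0 : Set BoolFun := at01 Const false false

/-- The constant functions with value `1`. -/
def Const1 : Set BoolFun := at01 Const true true

/-- The monotone functions. -/
def Mon : Set BoolFun := {f | Monotone f.val}

/-- The negation of a function. -/
def neg (f : BoolFun) : BoolFun := ⟨f.arity, fun a => !(f.val a)⟩

/-- The class of the negations of the members of `C`. -/
def negClass (C : Set BoolFun) : Set BoolFun := neg '' C

/-- The reflexive functions. -/
def Refl : Set BoolFun := {f | ∀ a, f.val a = f.val fun i => !(a i)}

/-- The projections. -/
def Proj : Set BoolFun := {f | ∃ i, ∀ a, f.val a = a i}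

/-- The `1`-separating functions of rank `k`: any at most `k` true points have a nonzero meet
(the meet of the empty set is `(1, …, 1)`). -/
def Sep (k : ℕ) : Set BoolFun :=
  {f | ∀ T : Finset (Fin f.arity → Bool),
    (∀ a ∈ T, f.val a = true) → T.card ≤ k → T.inf id ≠ ⊥}

/-- `MU^k_{01}`: the monotone `1`-separating functions of rank `k` with `f (0, …, 0) = 0` and
`f (1, …, 1) = 1`. -/
def MU01 (k : ℕ) : Set BoolFun := at01 (Mon ∩ Sep k) false true

/-! ### The minorant-minor order and its extensions -/

/-- `Minorant f g`: `f` and `g` have the same arity and `f ≤ g` pointwise. -/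
inductive Minorant : BoolFun → BoolFun → Prop
  | mk {n : ℕ+} {f g : BF n} (h : f ≤ g) : Minorant ⟨n, f⟩ ⟨n, g⟩

/-- `Minor f g`: `f` is a minor of `g`, that is, `f (a) = g (a ∘ σ)` for a minor formation
map `σ`. -/
inductive Minor : BoolFun → BoolFun → Prop
  | mk {m n : ℕ+} (g : BF m) (σ : Fin m → Fin n) : Minor ⟨n, fun a => g (a ∘ σ)⟩ ⟨m, g⟩

/-- `RelCl C f g`: `f` is the `C`-closure of `g`, the least majorant of `g` that lies in `C`. -/
inductive RelCl (C : Set BoolFun) : BoolFun → BoolFun → Prop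
  | mk {n : ℕ+} {f g : BF n} (h : IsLeast {u : BF n | g ≤ u ∧ (⟨n, u⟩ : BoolFun) ∈ C} f) :
      RelCl C ⟨n, f⟩ ⟨n, g⟩

/-- The minorant-minor quasiorder. -/
def MinMin : BoolFun → BoolFun → Prop :=
  Relation.TransGen fun f g => Minorant f g ∨ Minor f g

/-- The `C`-closed minorant-minor quasiorder. -/
def MinMinC (C : Set BoolFun) : BoolFun → BoolFun → Prop :=
  Relation.TransGen fun f g => Minorant f g ∨ Minor f g ∨ RelCl C f g

/-- The Boolean functions with at most `k` true points. -/
def AllLE (k : ℕ) : Set BoolFun :=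
  {f | (Finset.univ.filter fun a => f.val a = true).card ≤ k}

/-- `Θ` is an ideal (a possibly empty downset) of `AllLE k` with respect to the quasiorder `r`.
Such sets are unions of equivalence classes of `r` on `AllLE k`, and they correspond to the
downsets of the poset of these equivalence classes. -/
def IsIdealLE (k : ℕ) (r : BoolFun → BoolFun → Prop) (Θ : Set BoolFun) : Prop :=
  Θ ⊆ AllLE k ∧ ∀ g ∈ Θ, ∀ f ∈ AllLE k, r f g → f ∈ Θ

/-- The class `U^k(Θ)`: for every set `T` of at most `k` true points of `f` there are `θ ∈ Θ` and
a minor formation map `τ` such that `θ (a ∘ τ) = 1` for all `a ∈ T`. -/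
def UTheta (k : ℕ) (Θ : Set BoolFun) : Set BoolFun :=
  {f | ∀ T : Finset (Fin f.arity → Bool), (∀ a ∈ T, f.val a = true) → T.card ≤ k →
    ∃ θ ∈ Θ, ∃ τ : Fin θ.arity → Fin f.arity, ∀ a ∈ T, θ.val (a ∘ τ) = true}

end NUMinions

/-!
Let `K` be a clonoid with source `Proj` and target `MU01 k`. The target is so large that an `n`-ary
`f` belongs to `K` as soon as any at most `k` true points of `f` are covered by a member of `K`,
any true point is separated from any false point by a member of `K` (`Separates`), and every false
point is a false point of some member: one function `φ ∈ MU01 k` applied to all `n`-ary members of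
`K` then yields `f` (`IsClonoid.mem_of_separates`). The covering condition says exactly that `f` is
in `UTheta k (lowerPart k K)`, where `lowerPart k K` consists of the functions with at most `k` true
points below members of `K`.

Since `K` is closed under minors, whether it separates `a` from `b` depends only on the set of
letters `(a i, b i)`, and it increases with this set (`IsClonoid.separates_of_letters`). Up to this
information there are only ten kinds of functions (`Kind`). `Kind.Sep` lists pairs of points which a
function of a given kind separates by its minors, `Kind.Req` the pairs which may have to be
separated to obtain a function of that kind; comparing the two is propositional.

If the constant `1` is in `K`, the covering condition is void, `K` is a union of kinds, and the
combinations of kinds that are possible give the class of all functions and the 26 special classes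
(`IsClonoid.eq_of_const1_mem`). Otherwise no member of `K` has the value `1` at both `⊥` and `⊤`.
Then either all separations compatible with the covering condition are available and
`K = UTheta k (lowerPart k K)`, or the members of `K` that are not constant are all of kinds
`mono` and `up`, all of kinds `anti` and `down`, or all of kind `refl0`, which gives the remaining
five families (`IsClonoid.eq_of_const1_notMem`). In these, `lowerPart k K` is closed under
`C`-closures because every member of `K` has a majorant in `K ∩ C` (`IsClonoid.isIdealLE_minMinC`).

Conversely, `UTheta k Θ` is a clonoid for every `Θ` because of the separation property of `MU01 k`,
and all other classes are intersections of classes that fix the value at `⊥` or `⊤` or that are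
given by inequalities `f a ≤ f b` along a relation stable under minors (`Increasing`).
-/

namespace NUMinions

/-! ### Interpolation by the members of a clonoid -/

/-- Some `n`-ary member of `K` is true at `a` and false at `b`. -/
def Separates (K : Set BoolFun) {n : ℕ+} (a b : Fin n → Bool) : Prop :=
  ∃ g : BF n, (⟨n, g⟩ : BoolFun) ∈ K ∧ g a = true ∧ g b = false

/-- The members of `AllLE k` that lie below some member of `K`. -/
def lowerPart (k : ℕ) (K : Set BoolFun) : Set BoolFun :=
  {f | f ∈ AllLE k ∧ ∃ g ∈ K, Minorant f g}

theorem IsClonoid.minor_mem {C K : Set BoolFun} (hK : IsClonoid Proj C K) {m n : ℕ+} {g : BF m}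
    (hg : (⟨m, g⟩ : BoolFun) ∈ K) (σ : Fin m → Fin n) :
    (⟨n, fun a => g (a ∘ σ)⟩ : BoolFun) ∈ K :=
  hK.1 ⟨n, m, g, fun i a => a (σ i), hg, fun i => ⟨σ i, fun _ => rfl⟩, rfl⟩

/-- Membership in a clonoid with target `MU01 k` is a matter of covering at most `k` true points
and of separating pairs of points. The function `f` is obtained in one step: all `n`-ary members
`g₁, …, gₘ` of `K` are composed with the least monotone `φ` such that `φ (1, …, 1) = 1` and
`φ (g₁ a, …, gₘ a) = 1` for all true points `a` of `f`. The covering condition puts `φ` into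
`Sep k`; the two other conditions say that `φ` vanishes at the image of every false point. -/
theorem IsClonoid.mem_of_separates {k : ℕ} (hk : 1 ≤ k) {K : Set BoolFun}
    (hK : IsClonoid Proj (MU01 k) K) {n : ℕ+} {f : BF n}
    (hU : ∀ T : Finset (Fin n → Bool), (∀ a ∈ T, f a = true) → T.card ≤ k →
      ∃ g : BF n, (⟨n, g⟩ : BoolFun) ∈ K ∧ ∀ a ∈ T, g a = true)
    (hs : ∀ a b, f a = true → f b = false → Separates K a b)
    (h0 : ∀ b, f b = false → ∃ g : BF n, (⟨n, g⟩ : BoolFun) ∈ K ∧ g b = false) :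
    (⟨n, f⟩ : BoolFun) ∈ K := by
  classical
  let I := {g : BF n // (⟨n, g⟩ : BoolFun) ∈ K}
  obtain ⟨g₀, hg₀, -⟩ := hU ∅ (by simp) (by simp)
  have : Nonempty I := ⟨⟨g₀, hg₀⟩⟩
  let m : ℕ+ := ⟨Fintype.card I, Fintype.card_pos⟩
  let e : Fin m ≃ I := (Fintype.equivFin I).symm
  let v : (Fin n → Bool) → (Fin m → Bool) := fun a i => (e i).1 a
  let φ : BF m := fun w => decide (w = ⊤ ∨ ∃ a, f a = true ∧ v a ≤ w)
  have hφ_iff : ∀ w, φ w = true ↔ (w = ⊤ ∨ ∃ a, f a = true ∧ v a ≤ w) := fun w => by simp [φ]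
  have hmono : Monotone φ := by
    intro w w' hw
    rw [Bool.le_iff_imp, hφ_iff, hφ_iff]
    rintro (rfl | ⟨a, ha, hv⟩)
    · exact Or.inl (top_le_iff.1 hw)
    · exact Or.inr ⟨a, ha, hv.trans hw⟩
  have hsep : (⟨m, φ⟩ : BoolFun) ∈ Sep k := by
    intro T hT hcard hinf
    have hex : ∀ w : Fin m → Bool, ∃ a, w ∈ T → w ≠ ⊤ → f a = true ∧ v a ≤ w := by
      intro w
      by_cases hw : w ∈ T
      · rcases (hφ_iff w).1 (hT w hw) with h | ⟨a, ha⟩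
        · exact ⟨⊤, fun _ h' => absurd h h'⟩
        · exact ⟨a, fun _ _ => ha⟩
      · exact ⟨⊤, fun h => absurd h hw⟩
    choose α hα using hex
    obtain ⟨g, hg, hgT⟩ := hU ((T.filter (· ≠ ⊤)).image α)
      (by
        intro a ha
        obtain ⟨w, hw, rfl⟩ := Finset.mem_image.1 ha
        rw [Finset.mem_filter] at hw
        exact (hα w hw.1 hw.2).1)
      (Finset.card_image_le.trans ((Finset.card_filter_le _ _).trans hcard))
    let i : Fin m := e.symm ⟨g, hg⟩
    have hle : (fun j => decide (j = i)) ≤ T.inf id := by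
      refine Finset.le_inf fun w hw => ?_
      intro j
      rw [Bool.le_iff_imp, decide_eq_true_iff]
      rintro rfl
      by_cases hwt : w = ⊤
      · rw [hwt]; rfl
      · have h1 := (hα w hw hwt).2 i
        have h2 : v (α w) i = true := by
          have := hgT (α w) (Finset.mem_image_of_mem _ (Finset.mem_filter.2 ⟨hw, hwt⟩))
          simpa [v, i] using this
        exact Bool.le_iff_imp.1 h1 h2
    rw [hinf] at hle
    have := Bool.le_iff_imp.1 (hle i) (by simp)
    simp at this
  have hbot : φ ⊥ = false := by
    rw [Bool.eq_false_iff, Ne, hφ_iff]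
    intro h
    refine hsep {⊥} ?_ (by simpa using hk) (by simp)
    intro a ha
    rw [Finset.mem_singleton.1 ha]
    exact (hφ_iff _).2 h
  have htop : φ ⊤ = true := (hφ_iff _).2 (Or.inl rfl)
  have hφ : (⟨m, φ⟩ : BoolFun) ∈ MU01 k := ⟨⟨⟨hmono, hsep⟩, hbot⟩, ⟨⟨hmono, hsep⟩, htop⟩⟩
  have hf : f = fun a => φ fun i => (e i).1 a := by
    funext b
    rw [Bool.eq_iff_iff, hφ_iff]
    constructor
    · exact fun hb => Or.inr ⟨b, hb, le_rfl⟩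
    · intro h
      by_contra hb
      rw [Bool.not_eq_true] at hb
      rcases h with h | ⟨a, ha, hv⟩
      · obtain ⟨g, hg, hgb⟩ := h0 b hb
        have := congrFun h (e.symm ⟨g, hg⟩)
        simp [hgb] at this
      · obtain ⟨g, hg, hga, hgb⟩ := hs a b ha hb
        have := Bool.le_iff_imp.1 (hv (e.symm ⟨g, hg⟩)) (by simpa [v] using hga)
        simp [hgb] at this
  rw [hf]
  exact hK.2 ⟨n, m, φ, fun i => (e i).1, hφ, fun i => (e i).2, rfl⟩

/-- The witness for a set `T` of at most `k` true points is its characteristic function. -/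
theorem subset_UTheta_lowerPart (k : ℕ) (K : Set BoolFun) : K ⊆ UTheta k (lowerPart k K) := by
  classical
  rintro ⟨n, f⟩ hf T hT hcard
  refine ⟨⟨n, fun a => decide (a ∈ T)⟩, ⟨?_, ⟨n, f⟩, hf, ⟨?_⟩⟩, id, fun a ha => by simpa using ha⟩
  · simpa [AllLE] using hcard
  · intro a
    rw [Bool.le_iff_imp, decide_eq_true_iff]
    exact hT a

/-- `mem_of_separates` for functions with a true point, with the covering condition expressed
by `UTheta`. -/
theorem IsClonoid.mem_of_mem_UTheta {k : ℕ} (hk : 1 ≤ k) {K : Set BoolFun}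
    (hK : IsClonoid Proj (MU01 k) K) {f : BoolFun} (hf : f ∈ UTheta k (lowerPart k K))
    (hs : ∀ a b, f.val a = true → f.val b = false → Separates K a b)
    (h0 : ∃ a, f.val a = true) : f ∈ K := by
  obtain ⟨n, f⟩ := f
  refine hK.mem_of_separates hk ?_ hs ?_
  · intro T hT hcard
    obtain ⟨⟨m, θ⟩, ⟨-, -, hg, ⟨hle⟩⟩, τ, hτ⟩ := hf T hT hcard
    exact ⟨_, hK.minor_mem hg τ, fun a ha => Bool.le_iff_imp.1 (hle _) (hτ a ha)⟩
  · intro b hb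
    obtain ⟨a, ha⟩ := h0
    obtain ⟨g, hg, -, hgb⟩ := hs a b ha hb
    exact ⟨g, hg, hgb⟩

/-- Constants of one arity yield those of every arity. -/
theorem IsClonoid.const_mem {C K : Set BoolFun} (hK : IsClonoid Proj C K) {f g : BoolFun} {c : Bool}
    (hf : f ∈ K) (hbot : f.val ⊥ = c) (htop : f.val ⊤ = c) (hg : ∀ a, g.val a = c) : g ∈ K := by
  obtain ⟨m, f⟩ := f
  obtain ⟨n, g⟩ := g
  have h1 := hK.minor_mem hf (fun _ => (⟨0, n.pos⟩ : Fin n))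
  convert h1 using 2
  funext a
  rw [show g a = c from hg a]
  cases h : a ⟨0, n.pos⟩
  · rw [← hbot]; exact congrArg f (funext fun _ => h.symm)
  · rw [← htop]; exact congrArg f (funext fun _ => h.symm)

/-! ### Ideals of lower parts -/

/-- The lower part is an ideal for the transitive closure of `r` if having a majorant in `K` is
inherited downwards along `r`. -/
theorem isIdealLE_lowerPart {k : ℕ} {K : Set BoolFun} {r : BoolFun → BoolFun → Prop}
    (hr : ∀ f g, r f g → (∃ u ∈ K, Minorant g u) → ∃ u ∈ K, Minorant f u) :
    IsIdealLE k (Relation.TransGen r) (lowerPart k K) := by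
  refine ⟨fun f hf => hf.1, fun g hg f hf hfg => ⟨hf, ?_⟩⟩
  -- The chain from `f` to `g` may leave `AllLE k`, so only the majorant is carried along it.
  have : ∀ f g, Relation.TransGen r f g → (∃ u ∈ K, Minorant g u) → ∃ u ∈ K, Minorant f u := by
    intro f g h
    induction h using Relation.TransGen.head_induction_on with
    | single h => exact hr _ _ h
    | head h _ ih => exact fun hg => hr _ _ h (ih hg)
  exact this f g hfg hg.2

theorem Minorant.trans {f g h : BoolFun} (h₁ : Minorant f g) (h₂ : Minorant g h) :
    Minorant f h := by
  obtain ⟨h₁⟩ := h₁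
  obtain ⟨h₂⟩ := h₂
  exact ⟨h₁.trans h₂⟩

theorem IsClonoid.exists_majorant_of_minor {C K : Set BoolFun} (hK : IsClonoid Proj C K)
    {f g : BoolFun} (hfg : Minor f g) : (∃ u ∈ K, Minorant g u) → ∃ u ∈ K, Minorant f u := by
  obtain ⟨g, σ⟩ := hfg
  rintro ⟨_, hu, ⟨hle⟩⟩
  exact ⟨_, hK.minor_mem hu σ, ⟨fun a => hle _⟩⟩

theorem IsClonoid.isIdealLE_minMin {C K : Set BoolFun} (hK : IsClonoid Proj C K) (k : ℕ) :
    IsIdealLE k MinMin (lowerPart k K) := by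
  refine isIdealLE_lowerPart ?_
  rintro f g (h | h)
  · rintro ⟨u, hu, hgu⟩
    exact ⟨u, hu, h.trans hgu⟩
  · exact hK.exists_majorant_of_minor h

/-- The lower part is closed under `D`-closures as soon as every member of `K` has a majorant in
`K ∩ D`, since the `D`-closure of a function lies below all its majorants in `D`. -/
theorem IsClonoid.isIdealLE_minMinC {C K D : Set BoolFun} (hK : IsClonoid Proj C K) (k : ℕ)
    (hD : ∀ g ∈ K, ∃ u ∈ K, u ∈ D ∧ Minorant g u) :
    IsIdealLE k (MinMinC D) (lowerPart k K) := by
  refine isIdealLE_lowerPart ?_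
  rintro f g (h | h | h)
  · rintro ⟨u, hu, hgu⟩
    exact ⟨u, hu, h.trans hgu⟩
  · exact hK.exists_majorant_of_minor h
  · rintro ⟨u, hu, hgu⟩
    obtain ⟨w, hw, hwD, huw⟩ := hD u hu
    have hgw := hgu.trans huw
    obtain ⟨h⟩ := h
    obtain ⟨hle⟩ := hgw
    exact ⟨_, hw, ⟨h.2 ⟨hle, hwD⟩⟩⟩

theorem lowerPart_nonempty {k : ℕ} {K : Set BoolFun} (h : K.Nonempty) :
    (lowerPart k K).Nonempty := by
  obtain ⟨⟨n, f⟩, hf⟩ := h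
  exact ⟨⟨n, fun _ => false⟩, by simp [AllLE], ⟨n, f⟩, hf, ⟨fun a => Bool.false_le _⟩⟩

/-! ### Kinds of Boolean functions -/

/-- The ten kinds of Boolean functions, by the values at `⊥` and `⊤` and by whether the function is
constant, monotone, antitone or reflexive. In the case `f ⊥ < f ⊤` the kinds are `mono` and
`up` (not monotone), in the case `f ⊥ > f ⊤` they are `anti` and `down` (not antitone), and for
`f ⊥ = f ⊤ = c` they are the constants, the nonconstant reflexive functions and the nonreflexive
functions: `const0`, `refl0`, `eq0` for `c = 0` and `const1`, `refl1`, `eq1` for `c = 1`. -/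
inductive Kind
  | const0 | const1 | mono | up | anti | down | refl0 | eq0 | refl1 | eq1

open Classical in
/-- The kind of a Boolean function. -/
noncomputable def kind (f : BoolFun) : Kind :=
  match f.val ⊥, f.val ⊤ with
  | false, false => if f ∈ Const then .const0 else if f ∈ Refl then .refl0 else .eq0
  | true, true => if f ∈ Const then .const1 else if f ∈ Refl then .refl1 else .eq1
  | false, true => if f ∈ Mon then .mono else .up
  | true, false => if f ∈ negClass Mon then .anti else .down

/-- The value at `⊥` of the functions of a given kind. -/
def Kind.bot : Kind → Bool
  | .const0 | .refl0 | .eq0 | .mono | .up => false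
  | _ => true

/-- The value at `⊤` of the functions of a given kind. -/
def Kind.top : Kind → Bool
  | .const0 | .refl0 | .eq0 | .anti | .down => false
  | _ => true

theorem mem_negClass_Mon {f : BoolFun} : f ∈ negClass Mon ↔ Antitone f.val := by
  constructor
  · rintro ⟨g, hg, rfl⟩ a b hab
    have h : g.val a ≤ g.val b := hg hab
    change (!g.val b) ≤ (!g.val a)
    revert h
    cases g.val a <;> cases g.val b <;> decide
  · intro hf
    refine ⟨neg f, ?_, by simp [neg]⟩
    intro a b hab
    have h := hf hab
    change (!f.val a) ≤ (!f.val b)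
    revert h
    cases f.val a <;> cases f.val b <;> decide

theorem neg_bot (f : BoolFun) : (neg f).val ⊥ = !f.val ⊥ := rfl

theorem neg_top (f : BoolFun) : (neg f).val ⊤ = !f.val ⊤ := rfl

theorem mem_negClass_at0 {C : Set BoolFun} {f : BoolFun} {c : Bool} :
    f ∈ negClass (at0 C c) ↔ f ∈ negClass C ∧ f.val ⊥ = !c := by
  constructor
  · rintro ⟨g, ⟨hg, hc⟩, rfl⟩
    exact ⟨⟨g, hg, rfl⟩, by rw [neg_bot, hc]⟩
  · rintro ⟨⟨g, hg, rfl⟩, hc⟩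
    exact ⟨g, ⟨hg, by rw [neg_bot] at hc; simpa using hc⟩, rfl⟩

theorem mem_negClass_at1 {C : Set BoolFun} {f : BoolFun} {c : Bool} :
    f ∈ negClass (at1 C c) ↔ f ∈ negClass C ∧ f.val ⊤ = !c := by
  constructor
  · rintro ⟨g, ⟨hg, hc⟩, rfl⟩
    exact ⟨⟨g, hg, rfl⟩, by rw [neg_top, hc]⟩
  · rintro ⟨⟨g, hg, rfl⟩, hc⟩
    exact ⟨g, ⟨hg, by rw [neg_top] at hc; simpa using hc⟩, rfl⟩

theorem mem_negClass_at01 {C : Set BoolFun} {f : BoolFun} {c d : Bool} :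
    f ∈ negClass (at01 C c d) ↔ f ∈ negClass C ∧ f.val ⊥ = (!c) ∧ f.val ⊤ = !d := by
  constructor
  · rintro ⟨g, ⟨⟨hg, hc⟩, -, hd⟩, rfl⟩
    exact ⟨⟨g, hg, rfl⟩, by rw [neg_bot, hc], by rw [neg_top, hd]⟩
  · rintro ⟨⟨g, hg, rfl⟩, hc, hd⟩
    exact ⟨g, ⟨⟨hg, by rw [neg_bot] at hc; simpa using hc⟩,
      hg, by rw [neg_top] at hd; simpa using hd⟩, rfl⟩

theorem Mon_bot_top {f : BoolFun} (h : f ∈ Mon) (he : f.val ⊤ = f.val ⊥) : f ∈ Const := by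
  have key : ∀ a, f.val a = f.val ⊥ := fun a =>
    le_antisymm ((h le_top).trans he.le) (h bot_le)
  exact fun a b => (key a).trans (key b).symm

theorem Antitone_bot_top {f : BoolFun} (h : Antitone f.val) (he : f.val ⊤ = f.val ⊥) :
    f ∈ Const := by
  have key : ∀ a, f.val a = f.val ⊥ := fun a =>
    le_antisymm (h bot_le) (he.ge.trans (h le_top))
  exact fun a b => (key a).trans (key b).symm

theorem Refl_bot_top {f : BoolFun} (h : f ∈ Refl) : f.val ⊤ = f.val ⊥ := h ⊤

theorem Const_bot_top {f : BoolFun} (h : f ∈ Const) : f.val ⊤ = f.val ⊥ := h ⊤ ⊥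

theorem Const_subset_Mon : Const ⊆ Mon := fun _ h a b _ => (h a b).le

theorem Const_subset_Refl : Const ⊆ Refl := fun _ h a => h a _

theorem Const_antitone {f : BoolFun} (h : f ∈ Const) : Antitone f.val := fun a b _ => (h b a).le

/-- All the properties in terms of which the classes are defined can be read off from the kind. -/
theorem kind_spec (f : BoolFun) :
    (f.val ⊥ = (kind f).bot ∧ f.val ⊤ = (kind f).top) ∧
    (f ∈ Const ↔ kind f = .const0 ∨ kind f = .const1) ∧
    (f ∈ Mon ↔ kind f = .const0 ∨ kind f = .const1 ∨ kind f = .mono) ∧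
    (f ∈ negClass Mon ↔ kind f = .const0 ∨ kind f = .const1 ∨ kind f = .anti) ∧
    (f ∈ Refl ↔ kind f = .const0 ∨ kind f = .const1 ∨ kind f = .refl0 ∨ kind f = .refl1) := by
  have h1 := @Mon_bot_top f
  have h2 := @Antitone_bot_top f
  rw [← mem_negClass_Mon] at h2
  have h3 := @Refl_bot_top f
  have h4 := @Const_bot_top f
  have h5 := @Const_subset_Mon f
  have h6 := @Const_subset_Refl f
  have h7 := @Const_antitone f
  rw [← mem_negClass_Mon] at h7
  have hle : f ∈ Mon → f.val ⊥ ≤ f.val ⊤ := fun h => h bot_le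
  have hge : f ∈ negClass Mon → f.val ⊤ ≤ f.val ⊥ := fun h => mem_negClass_Mon.1 h bot_le
  unfold kind
  revert h1 h2 h3 h4 hle hge
  generalize f.val ⊥ = p
  generalize f.val ⊤ = q
  intro h1 h2 h3 h4 hle hge
  cases p <;> cases q <;> dsimp only <;> split_ifs <;> simp_all [Kind.bot, Kind.top] <;> tauto

/-! ### Letters of a pair of points -/

/-- Some position carries `p` in `a` and `q` in `b`. -/
def Letter {n : ℕ+} (a b : Fin n → Bool) (p q : Bool) : Prop := ∃ j, a j = p ∧ b j = q

/-- If every letter of `(c, d)` occurs in `(a, b)`, then `c = a ∘ σ` and `d = b ∘ σ` for some `σ`,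
and the minor formed with `σ` separates `a` from `b`. -/
theorem IsClonoid.separates_of_letters {C K : Set BoolFun} (hK : IsClonoid Proj C K) {m n : ℕ+}
    {g : BF m} (hg : (⟨m, g⟩ : BoolFun) ∈ K) {c d : Fin m → Bool} (hc : g c = true)
    (hd : g d = false) {a b : Fin n → Bool} (h : ∀ i, Letter a b (c i) (d i)) :
    Separates K a b := by
  choose σ hσ₁ hσ₂ using h
  refine ⟨_, hK.minor_mem hg σ, ?_, ?_⟩
  · rw [← hc]; exact congrArg g (funext hσ₁)
  · rw [← hd]; exact congrArg g (funext hσ₂)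

/-- A condition on the letters `o = 00`, `i = 11`, `x = 01`, `y = 10` of a pair `(a, b)` under which
the minors of any function of the given kind separate `a` from `b`. -/
def Kind.Sep : Kind → (o i x y : Prop) → Prop
  | .const0, _, _, _, _ | .const1, _, _, _, _ => False
  | .mono, _, _, _, y => y
  | .up, o, i, x, y => y ∨ o ∧ i ∧ x
  | .anti, _, _, x, _ => x
  | .down, o, i, x, y => x ∨ o ∧ i ∧ y
  | .refl0, o, i, x, y => o ∧ y ∨ x ∧ i
  | .eq0, o, i, x, y => o ∧ y ∨ x ∧ i ∨ x ∧ y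
  | .refl1, o, i, x, y => o ∧ x ∨ i ∧ y
  | .eq1, o, i, x, y => o ∧ x ∨ i ∧ y ∨ x ∧ y

/-- What the letters of a pair `(a, b)` satisfy when `f a = 1` and `f b = 0` for a function `f` of
the given kind. -/
def Kind.Req : Kind → (o i x y : Prop) → Prop
  | .const0, _, _, _, _ | .const1, _, _, _, _ => False
  | .mono, _, _, _, y => y
  | .up, o, i, x, y => (x ∨ y) ∧ (y ∨ i) ∧ (o ∨ y)
  | .anti, _, _, x, _ => x
  | .down, o, i, x, y => (x ∨ y) ∧ (x ∨ i) ∧ (o ∨ x)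
  | .refl0, o, i, x, y => (x ∨ y) ∧ (y ∨ i) ∧ (o ∨ x) ∧ (o ∨ i)
  | .eq0, o, i, x, y => (x ∨ y) ∧ (y ∨ i) ∧ (o ∨ x)
  | .refl1, o, i, x, y => (x ∨ y) ∧ (x ∨ i) ∧ (o ∨ y) ∧ (o ∨ i)
  | .eq1, o, i, x, y => (x ∨ y) ∧ (x ∨ i) ∧ (o ∨ y)

theorem IsClonoid.separates_of_kind {C K : Set BoolFun} (hK : IsClonoid Proj C K) {f : BoolFun}
    (hf : f ∈ K) {n : ℕ+} {a b : Fin n → Bool}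
    (h : (kind f).Sep (Letter a b false false) (Letter a b true true) (Letter a b false true)
      (Letter a b true false)) : Separates K a b := by
  obtain ⟨⟨hbot, htop⟩, hconst, hmon, hanti, hrefl⟩ := kind_spec f
  obtain ⟨m, f⟩ := f
  -- A pair has at most two letters if one of its points is constant or if its points are
  -- complementary.
  have hsep : ∀ c d, f c = true → f d = false → (∀ i, Letter a b (c i) (d i)) → Separates K a b :=
    fun c d hc hd => hK.separates_of_letters hf hc hd
  have hleft : ∀ (p : Bool) d, f (fun _ => p) = true → f d = false → Letter a b p false →
      Letter a b p true → Separates K a b := by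
    intro p d hc hd h0 h1
    refine hsep _ d hc hd fun i => ?_
    cases d i <;> assumption
  have hright : ∀ (q : Bool) c, f c = true → f (fun _ => q) = false → Letter a b false q →
      Letter a b true q → Separates K a b := by
    intro q c hc hd h0 h1
    refine hsep c _ hc hd fun i => ?_
    cases c i <;> assumption
  have hcompl : ∀ c, f c = true → f (fun i => !c i) = false → Letter a b false true →
      Letter a b true false → Separates K a b := by
    intro c hc hd h0 h1
    refine hsep c _ hc hd fun i => ?_
    cases c i <;> assumption
  have hnc : (⟨m, f⟩ : BoolFun) ∉ Const → (∃ c, f c = true) ∧ ∃ d, f d = false := by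
    intro h
    constructor
    · by_contra! h'
      exact h fun a b => (Bool.eq_false_iff.2 (h' a)).trans (Bool.eq_false_iff.2 (h' b)).symm
    · by_contra! h'
      exact h fun a b => (Bool.eq_true_of_not_eq_false (h' a)).trans
        (Bool.eq_true_of_not_eq_false (h' b)).symm
  have hnr : (⟨m, f⟩ : BoolFun) ∉ Refl → ∃ c, f c = true ∧ f (fun i => !c i) = false := by
    intro h
    by_contra! h'
    refine h fun a => ?_
    have h1 := h' a
    have h2 := h' (fun i => !a i)
    simp only [Bool.not_not] at h2
    change f a = f fun i => !a i
    cases h3 : f a <;> cases h4 : f fun i => !a i <;> simp_all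
  change f (fun _ => false) = _ at hbot
  change f (fun _ => true) = _ at htop
  cases hk : kind ⟨m, f⟩ <;> rw [hk] at h hbot htop hconst hmon hanti hrefl <;>
    simp only [Kind.Sep, Kind.bot, Kind.top, reduceCtorEq, or_false, or_true, or_self, iff_false,
      iff_true] at h hbot htop hconst hmon hanti hrefl
  · exact hsep _ _ htop hbot fun _ => h
  · rcases h with h | ⟨h1, h2, h3⟩
    · exact hsep _ _ htop hbot fun _ => h
    · obtain ⟨c, d, hcd, hlt⟩ : ∃ c d, c ≤ d ∧ ¬ f c ≤ f d := by
        by_contra! h'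
        exact hmon fun c d hcd => h' c d hcd
      rw [Bool.le_iff_imp, Classical.not_imp, Bool.not_eq_true] at hlt
      obtain ⟨hc, hd⟩ := hlt
      refine hsep c d hc hd fun i => ?_
      have := hcd i
      revert this
      cases c i <;> cases d i <;> simp_all
  · exact hsep _ _ hbot htop fun _ => h
  · rcases h with h | ⟨h1, h2, h3⟩
    · exact hsep _ _ hbot htop fun _ => h
    · obtain ⟨d, c, hcd, hlt⟩ : ∃ d c, d ≤ c ∧ ¬ f c ≤ f d := by
        by_contra! h'
        exact hanti (mem_negClass_Mon.2 fun c d hcd => h' c d hcd)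
      rw [Bool.le_iff_imp, Classical.not_imp, Bool.not_eq_true] at hlt
      obtain ⟨hc, hd⟩ := hlt
      refine hsep c d hc hd fun i => ?_
      have := hcd i
      revert this
      cases c i <;> cases d i <;> simp_all
  · obtain ⟨⟨c, hc⟩, -⟩ := hnc hconst
    rcases h with ⟨h1, h2⟩ | ⟨h1, h2⟩
    · exact hright _ c hc hbot h1 h2
    · exact hright _ c hc htop h1 h2
  · obtain ⟨⟨c, hc⟩, -⟩ := hnc hconst
    rcases h with ⟨h1, h2⟩ | ⟨h1, h2⟩ | ⟨h1, h2⟩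
    · exact hright _ c hc hbot h1 h2
    · exact hright _ c hc htop h1 h2
    · obtain ⟨c, hc, hd⟩ := hnr hrefl
      exact hcompl c hc hd h1 h2
  · obtain ⟨-, d, hd⟩ := hnc hconst
    rcases h with ⟨h1, h2⟩ | ⟨h1, h2⟩
    · exact hleft _ d hbot hd h1 h2
    · exact hleft _ d htop hd h2 h1
  · obtain ⟨-, d, hd⟩ := hnc hconst
    rcases h with ⟨h1, h2⟩ | ⟨h1, h2⟩ | ⟨h1, h2⟩
    · exact hleft _ d hbot hd h1 h2
    · exact hleft _ d htop hd h2 h1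
    · obtain ⟨c, hc, hd⟩ := hnr hrefl
      exact hcompl c hc hd h1 h2

/-- `Kind.Req` is necessary for `f a = 1` and `f b = 0`: for example `a ≠ b` gives the letter `x` or
`y`, and `f ⊥ = 0` gives `a ≠ ⊥`, hence the letter `y` or `i`. -/
theorem req_of_kind {f : BoolFun} {a b : Fin f.arity → Bool} (ha : f.val a = true)
    (hb : f.val b = false) :
    (kind f).Req (Letter a b false false) (Letter a b true true) (Letter a b false true)
      (Letter a b true false) := by
  obtain ⟨⟨hbot, htop⟩, hconst, hmon, hanti, hrefl⟩ := kind_spec f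
  have hne : ∃ j, a j ≠ b j := by
    rw [← Function.ne_iff]; rintro rfl; simp_all
  have ha0 : f.val ⊥ = false → ∃ j, a j = true := by
    intro h
    by_contra! h'
    rw [show a = ⊥ from funext fun j => Bool.eq_false_iff.2 (h' j), h] at ha
    cases ha
  have ha1 : f.val ⊤ = false → ∃ j, a j = false := by
    intro h
    by_contra! h'
    rw [show a = ⊤ from funext fun j => Bool.eq_true_of_not_eq_false (h' j), h] at ha
    cases ha
  have hb0 : f.val ⊥ = true → ∃ j, b j = true := by
    intro h
    by_contra! h'
    rw [show b = ⊥ from funext fun j => Bool.eq_false_iff.2 (h' j), h] at hb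
    cases hb
  have hb1 : f.val ⊤ = true → ∃ j, b j = false := by
    intro h
    by_contra! h'
    rw [show b = ⊤ from funext fun j => Bool.eq_true_of_not_eq_false (h' j), h] at hb
    cases hb
  have hr : f ∈ Refl → ∃ j, a j = b j := by
    intro h
    by_contra! h'
    rw [h a, show (fun i => !a i) = b from funext fun j => by
      have := h' j; revert this; cases a j <;> cases b j <;> simp, hb] at ha
    cases ha
  have hm : f ∈ Mon → Letter a b true false := by
    intro h
    by_contra h'
    have : a ≤ b := fun j => Bool.le_iff_imp.2 fun hj => by
      by_contra hbj
      exact h' ⟨j, hj, Bool.eq_false_iff.2 hbj⟩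
    have := Bool.le_iff_imp.1 (h this) ha
    simp_all
  have han : f ∈ negClass Mon → Letter a b false true := by
    intro h
    by_contra h'
    have : b ≤ a := fun j => Bool.le_iff_imp.2 fun hj => by
      by_contra hbj
      exact h' ⟨j, Bool.eq_false_iff.2 hbj, hj⟩
    have := Bool.le_iff_imp.1 (mem_negClass_Mon.1 h this) ha
    simp_all
  -- The positions found above carry one of two letters each.
  have lne : (∃ j, a j ≠ b j) → Letter a b false true ∨ Letter a b true false := by
    rintro ⟨j, hj⟩
    cases h1 : a j <;> cases h2 : b j <;> simp_all
    · exact Or.inl ⟨j, h1, h2⟩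
    · exact Or.inr ⟨j, h1, h2⟩
  have leq : (∃ j, a j = b j) → Letter a b false false ∨ Letter a b true true := by
    rintro ⟨j, hj⟩
    cases h1 : a j
    · exact Or.inl ⟨j, h1, hj ▸ h1⟩
    · exact Or.inr ⟨j, h1, hj ▸ h1⟩
  have la : ∀ p, (∃ j, a j = p) → Letter a b p false ∨ Letter a b p true := by
    rintro p ⟨j, hj⟩
    cases h : b j
    · exact Or.inl ⟨j, hj, h⟩
    · exact Or.inr ⟨j, hj, h⟩
  have lb : ∀ p, (∃ j, b j = p) → Letter a b false p ∨ Letter a b true p := by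
    rintro p ⟨j, hj⟩
    cases h : a j
    · exact Or.inl ⟨j, h, hj⟩
    · exact Or.inr ⟨j, h, hj⟩
  have h1 := lne hne
  have h2 := fun h => la _ (ha0 h)
  have h3 := fun h => la _ (ha1 h)
  have h4 := fun h => lb _ (hb0 h)
  have h5 := fun h => lb _ (hb1 h)
  have h6 := fun h => leq (hr h)
  have hc : f ∉ Const := fun h => by
    have := h a b
    simp_all
  clear lne leq la lb hr hb0 hb1 ha0 ha1 hne ha hb
  rw [hconst] at hc
  rw [hmon] at hm
  rw [hanti] at han
  rw [hrefl] at h6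
  rw [hbot] at h2 h4
  rw [htop] at h3 h5
  clear hconst hmon hanti hrefl hbot htop
  cases hk : kind f <;> rw [hk] at h2 h3 h4 h5 h6 hm han hc
  · exact hc (Or.inl rfl)
  · exact hc (Or.inr rfl)
  · exact hm (Or.inr (Or.inr rfl))
  · exact ⟨h1, h2 rfl, h5 rfl⟩
  · exact han (Or.inr (Or.inr rfl))
  · exact ⟨h1, h4 rfl, h3 rfl⟩
  · exact ⟨h1, h2 rfl, h3 rfl, h6 (Or.inr (Or.inr (Or.inl rfl)))⟩
  · exact ⟨h1, h2 rfl, h3 rfl⟩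
  · exact ⟨h1, h4 rfl, h5 rfl, h6 (Or.inr (Or.inr (Or.inr rfl)))⟩
  · exact ⟨h1, h4 rfl, h5 rfl⟩

/-! ### The classes as unions of kinds -/

theorem mem_at0 {C : Set BoolFun} {f : BoolFun} {c : Bool} :
    f ∈ at0 C c ↔ f ∈ C ∧ f.val ⊥ = c := Iff.rfl

theorem mem_at1 {C : Set BoolFun} {f : BoolFun} {c : Bool} :
    f ∈ at1 C c ↔ f ∈ C ∧ f.val ⊤ = c := Iff.rfl

theorem mem_at01 {C : Set BoolFun} {f : BoolFun} {c d : Bool} :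
    f ∈ at01 C c d ↔ f ∈ C ∧ f.val ⊥ = c ∧ f.val ⊤ = d := by
  simp only [at01, Set.mem_inter_iff, mem_at0, mem_at1]; tauto

theorem mem_All (f : BoolFun) : f ∈ All := trivial

theorem kind_bot (f : BoolFun) : f.val ⊥ = (kind f).bot := (kind_spec f).1.1

theorem kind_top (f : BoolFun) : f.val ⊤ = (kind f).top := (kind_spec f).1.2

theorem mem_Const_iff (f : BoolFun) : f ∈ Const ↔ kind f = .const0 ∨ kind f = .const1 :=
  (kind_spec f).2.1

theorem mem_Mon_iff (f : BoolFun) :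
    f ∈ Mon ↔ kind f = .const0 ∨ kind f = .const1 ∨ kind f = .mono :=
  (kind_spec f).2.2.1

theorem mem_negClass_Mon_iff (f : BoolFun) :
    f ∈ negClass Mon ↔ kind f = .const0 ∨ kind f = .const1 ∨ kind f = .anti :=
  (kind_spec f).2.2.2.1

theorem mem_Refl_iff (f : BoolFun) :
    f ∈ Refl ↔ kind f = .const0 ∨ kind f = .const1 ∨ kind f = .refl0 ∨ kind f = .refl1 :=
  (kind_spec f).2.2.2.2

section Table

attribute [local simp] OmLe OmGe OmEq Om Const0 Const1 Kind.bot Kind.top mem_at0 mem_at1 mem_at01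
  mem_All mem_negClass_at0 mem_negClass_at1 mem_negClass_at01 kind_bot kind_top mem_Const_iff
  mem_Mon_iff mem_negClass_Mon_iff mem_Refl_iff

theorem mem_OmLe_iff (f : BoolFun) :
    f ∈ OmLe ↔
      kind f = .const0 ∨ kind f = .const1 ∨ kind f = .mono ∨ kind f = .up ∨
      kind f = .refl0 ∨ kind f = .eq0 ∨ kind f = .refl1 ∨ kind f = .eq1 := by
  simp; cases kind f <;> simp

theorem mem_OmGe_iff (f : BoolFun) :
    f ∈ OmGe ↔
      kind f = .const0 ∨ kind f = .const1 ∨ kind f = .anti ∨ kind f = .down ∨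
      kind f = .refl0 ∨ kind f = .eq0 ∨ kind f = .refl1 ∨ kind f = .eq1 := by
  simp; cases kind f <;> simp

theorem mem_OmEq_iff (f : BoolFun) :
    f ∈ OmEq ↔
      kind f = .const0 ∨ kind f = .const1 ∨ kind f = .refl0 ∨ kind f = .eq0 ∨
      kind f = .refl1 ∨ kind f = .eq1 := by
  simp; cases kind f <;> simp

theorem mem_at0_All_0_union_Const_iff (f : BoolFun) :
    f ∈ at0 All false ∪ Const ↔
      kind f = .const0 ∨ kind f = .const1 ∨ kind f = .mono ∨ kind f = .up ∨
      kind f = .refl0 ∨ kind f = .eq0 := by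
  simp; cases kind f <;> simp

theorem mem_at1_All_0_union_Const_iff (f : BoolFun) :
    f ∈ at1 All false ∪ Const ↔
      kind f = .const0 ∨ kind f = .const1 ∨ kind f = .anti ∨ kind f = .down ∨
      kind f = .refl0 ∨ kind f = .eq0 := by
  simp; cases kind f <;> simp

theorem mem_at0_All_1_union_Const_iff (f : BoolFun) :
    f ∈ at0 All true ∪ Const ↔
      kind f = .const0 ∨ kind f = .const1 ∨ kind f = .anti ∨ kind f = .down ∨
      kind f = .refl1 ∨ kind f = .eq1 := by
  simp; cases kind f <;> simp

theorem mem_at1_All_1_union_Const_iff (f : BoolFun) :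
    f ∈ at1 All true ∪ Const ↔
      kind f = .const0 ∨ kind f = .const1 ∨ kind f = .mono ∨ kind f = .up ∨
      kind f = .refl1 ∨ kind f = .eq1 := by
  simp; cases kind f <;> simp

theorem mem_Om_0_0_union_Const_iff (f : BoolFun) :
    f ∈ Om false false ∪ Const ↔
      kind f = .const0 ∨ kind f = .const1 ∨ kind f = .refl0 ∨ kind f = .eq0 := by
  simp; cases kind f <;> simp

theorem mem_Om_0_1_union_Const_iff (f : BoolFun) :
    f ∈ Om false true ∪ Const ↔
      kind f = .const0 ∨ kind f = .const1 ∨ kind f = .mono ∨ kind f = .up := by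
  simp; cases kind f <;> simp

theorem mem_Om_1_0_union_Const_iff (f : BoolFun) :
    f ∈ Om true false ∪ Const ↔
      kind f = .const0 ∨ kind f = .const1 ∨ kind f = .anti ∨ kind f = .down := by
  simp; cases kind f <;> simp

theorem mem_Om_1_1_union_Const_iff (f : BoolFun) :
    f ∈ Om true true ∪ Const ↔
      kind f = .const0 ∨ kind f = .const1 ∨ kind f = .refl1 ∨ kind f = .eq1 := by
  simp; cases kind f <;> simp

theorem mem_Om_0_1_union_Const1_iff (f : BoolFun) :
    f ∈ Om false true ∪ Const1 ↔ kind f = .const1 ∨ kind f = .mono ∨ kind f = .up := by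
  simp; cases kind f <;> simp

theorem mem_Om_1_0_union_Const1_iff (f : BoolFun) :
    f ∈ Om true false ∪ Const1 ↔ kind f = .const1 ∨ kind f = .anti ∨ kind f = .down := by
  simp; cases kind f <;> simp

theorem mem_at0_All_1_iff (f : BoolFun) :
    f ∈ at0 All true ↔
      kind f = .const1 ∨ kind f = .anti ∨ kind f = .down ∨ kind f = .refl1 ∨ kind f = .eq1 := by
  simp; cases kind f <;> simp

theorem mem_at1_All_1_iff (f : BoolFun) :
    f ∈ at1 All true ↔
      kind f = .const1 ∨ kind f = .mono ∨ kind f = .up ∨ kind f = .refl1 ∨ kind f = .eq1 := by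
  simp; cases kind f <;> simp

theorem mem_Om_1_1_iff (f : BoolFun) :
    f ∈ Om true true ↔ kind f = .const1 ∨ kind f = .refl1 ∨ kind f = .eq1 := by
  simp; cases kind f <;> simp

theorem mem_at1_Mon_1_iff (f : BoolFun) :
    f ∈ at1 Mon true ↔ kind f = .const1 ∨ kind f = .mono := by
  simp; cases kind f <;> simp

theorem mem_negClass_at0_Mon_0_iff (f : BoolFun) :
    f ∈ negClass (at0 Mon false) ↔ kind f = .const1 ∨ kind f = .anti := by
  simp; cases kind f <;> simp

theorem mem_at01_Refl_0_0_union_Const_iff (f : BoolFun) :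
    f ∈ at01 Refl false false ∪ Const ↔ kind f = .const0 ∨ kind f = .const1 ∨ kind f = .refl0 := by
  simp; cases kind f <;> simp

theorem mem_at01_Refl_1_1_union_Const_iff (f : BoolFun) :
    f ∈ at01 Refl true true ∪ Const ↔ kind f = .const0 ∨ kind f = .const1 ∨ kind f = .refl1 := by
  simp; cases kind f <;> simp

theorem mem_at01_Refl_1_1_iff (f : BoolFun) :
    f ∈ at01 Refl true true ↔ kind f = .const1 ∨ kind f = .refl1 := by
  simp; cases kind f <;> simp

theorem mem_Const1_iff (f : BoolFun) :
    f ∈ Const1 ↔ kind f = .const1 := by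
  simp; cases kind f <;> simp

theorem mem_Om_0_1_union_Const0_iff (f : BoolFun) :
    f ∈ Om false true ∪ Const0 ↔ kind f = .const0 ∨ kind f = .mono ∨ kind f = .up := by
  simp; cases kind f <;> simp

theorem mem_Om_1_0_union_Const0_iff (f : BoolFun) :
    f ∈ Om true false ∪ Const0 ↔ kind f = .const0 ∨ kind f = .anti ∨ kind f = .down := by
  simp; cases kind f <;> simp

theorem mem_Om_0_1_iff (f : BoolFun) :
    f ∈ Om false true ↔ kind f = .mono ∨ kind f = .up := by
  simp; cases kind f <;> simp

theorem mem_Om_1_0_iff (f : BoolFun) :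
    f ∈ Om true false ↔ kind f = .anti ∨ kind f = .down := by
  simp; cases kind f <;> simp

theorem mem_at0_Mon_0_iff (f : BoolFun) :
    f ∈ at0 Mon false ↔ kind f = .const0 ∨ kind f = .mono := by
  simp; cases kind f <;> simp

theorem mem_at01_Mon_0_1_iff (f : BoolFun) :
    f ∈ at01 Mon false true ↔ kind f = .mono := by
  simp; cases kind f <;> simp

theorem mem_negClass_at1_Mon_1_iff (f : BoolFun) :
    f ∈ negClass (at1 Mon true) ↔ kind f = .const0 ∨ kind f = .anti := by
  simp; cases kind f <;> simp

theorem mem_negClass_at01_Mon_0_1_iff (f : BoolFun) :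
    f ∈ negClass (at01 Mon false true) ↔ kind f = .anti := by
  simp; cases kind f <;> simp

theorem mem_at01_Refl_0_0_iff (f : BoolFun) :
    f ∈ at01 Refl false false ↔ kind f = .const0 ∨ kind f = .refl0 := by
  simp; cases kind f <;> simp

end Table

/-! ### The listed classes are clonoids -/

theorem isClonoid_of_minor {C K : Set BoolFun}
    (hminor : ∀ {m n : ℕ+} (f : BF m) (σ : Fin m → Fin n), (⟨m, f⟩ : BoolFun) ∈ K →
      (⟨n, fun a => f (a ∘ σ)⟩ : BoolFun) ∈ K) (hcomp : compClass C K ⊆ K) :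
    IsClonoid Proj C K := by
  refine ⟨?_, hcomp⟩
  rintro _ ⟨m, n, f, g, hf, hg, rfl⟩
  choose σ hσ using hg
  have : (fun a => f fun i => g i a) = fun a => f (a ∘ σ) := by
    funext a
    exact congrArg f (funext fun i => hσ i a)
  rw [this]
  exact hminor f σ hf

theorem IsClonoid.inter {C₁ C₂ K L : Set BoolFun} (hK : IsClonoid C₁ C₂ K)
    (hL : IsClonoid C₁ C₂ L) : IsClonoid C₁ C₂ (K ∩ L) := by
  constructor
  · rintro _ ⟨m, n, f, g, hf, hg, rfl⟩
    exact ⟨hK.1 ⟨m, n, f, g, hf.1, hg, rfl⟩, hL.1 ⟨m, n, f, g, hf.2, hg, rfl⟩⟩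
  · rintro _ ⟨m, n, f, g, hf, hg, rfl⟩
    exact ⟨hK.2 ⟨m, n, f, g, hf, fun i => (hg i).1, rfl⟩,
      hL.2 ⟨m, n, f, g, hf, fun i => (hg i).2, rfl⟩⟩

/-- Closure under `MU01 k` rests on the separation property: a true point of `φ (g₁, …, gₙ)` is
mapped to a true point of `φ`, and at most `k` of these share a coordinate that is `1`. -/
theorem isClonoid_UTheta (k : ℕ) (Θ : Set BoolFun) : IsClonoid Proj (MU01 k) (UTheta k Θ) := by
  classical
  refine isClonoid_of_minor ?_ ?_
  · intro m n f σ hf T hT hcard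
    obtain ⟨θ, hθ, τ, hτ⟩ := hf (T.image (· ∘ σ))
      (by
        intro a ha
        obtain ⟨b, hb, rfl⟩ := Finset.mem_image.1 ha
        exact hT b hb)
      (Finset.card_image_le.trans hcard)
    exact ⟨θ, hθ, σ ∘ τ, fun a ha => hτ _ (Finset.mem_image_of_mem _ ha)⟩
  · rintro _ ⟨m, n, φ, g, hφ, hg, rfl⟩ T hT hcard
    -- The images of `T` under `g` are true points of `φ`, so that some `g i` is true on `T`.
    have hne := hφ.1.1.2 (T.image fun a i => g i a)
      (by
        intro w hw
        obtain ⟨b, hb, rfl⟩ := Finset.mem_image.1 hw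
        exact hT b hb)
      (Finset.card_image_le.trans hcard)
    obtain ⟨i, hi⟩ : ∃ i, (T.image fun a i => g i a).inf id i = true := by
      by_contra! h
      exact hne (funext fun i => Bool.eq_false_iff.2 (h i))
    refine hg i T (fun a ha => ?_) hcard
    have hle : (T.image fun a i => g i a).inf id ≤ id fun i => g i a :=
      Finset.inf_le (Finset.mem_image_of_mem (fun a i => g i a) ha)
    exact Bool.le_iff_imp.1 (hle i) hi

theorem isClonoid_at0_All (k : ℕ) (c : Bool) : IsClonoid Proj (MU01 k) (at0 All c) := by
  refine isClonoid_of_minor (fun f σ hf => ⟨trivial, hf.2⟩) ?_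
  rintro _ ⟨m, n, φ, g, hφ, hg, rfl⟩
  refine ⟨trivial, ?_⟩
  change φ (fun i => g i ⊥) = c
  rw [show (fun i => g i ⊥) = fun _ => c from funext fun i => (hg i).2]
  cases c
  · exact hφ.1.2
  · exact hφ.2.2

theorem isClonoid_at1_All (k : ℕ) (c : Bool) : IsClonoid Proj (MU01 k) (at1 All c) := by
  refine isClonoid_of_minor (fun f σ hf => ⟨trivial, hf.2⟩) ?_
  rintro _ ⟨m, n, φ, g, hφ, hg, rfl⟩
  refine ⟨trivial, ?_⟩
  change φ (fun i => g i ⊤) = c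
  rw [show (fun i => g i ⊤) = fun _ => c from funext fun i => (hg i).2]
  cases c
  · exact hφ.1.2
  · exact hφ.2.2

/-- The functions with `f a ≤ f b` for all pairs `(a, b)` in the relation `ρ`. -/
def Increasing (ρ : ∀ n : ℕ+, (Fin n → Bool) → (Fin n → Bool) → Prop) : Set BoolFun :=
  {f | ∀ a b, ρ f.arity a b → f.val a ≤ f.val b}

theorem isClonoid_Increasing (k : ℕ) {ρ : ∀ n : ℕ+, (Fin n → Bool) → (Fin n → Bool) → Prop}
    (hρ : ∀ {m n : ℕ+} (σ : Fin m → Fin n) a b, ρ n a b → ρ m (a ∘ σ) (b ∘ σ)) :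
    IsClonoid Proj (MU01 k) (Increasing ρ) := by
  refine isClonoid_of_minor (fun f σ hf a b hab => hf _ _ (hρ σ a b hab)) ?_
  rintro _ ⟨m, n, φ, g, hφ, hg, rfl⟩ a b hab
  exact hφ.1.1.1 fun i => hg i a b hab

/-- This union is the class of all `f` with `f ⊥ ≤ f b` for all `b`: if `f ⊥ = 1`, the inequalities
force `f` to be constant. The next three classes arise in the same way. -/
theorem isClonoid_botLe (k : ℕ) : IsClonoid Proj (MU01 k) (at0 All false ∪ Const) := by
  convert isClonoid_Increasing k (ρ := fun _ a _ => a = ⊥) (by rintro m n σ _ b rfl; rfl) using 1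
  ext f
  constructor
  · rintro (⟨-, h⟩ | h) a b rfl
    · rw [h]; exact Bool.false_le _
    · exact (h _ _).le
  · intro h
    cases hb : f.val ⊥
    · exact Or.inl ⟨trivial, hb⟩
    · have : ∀ a, f.val a = true := fun a => Bool.le_iff_imp.1 (h ⊥ a rfl) hb
      exact Or.inr fun a b => (this a).trans (this b).symm

theorem isClonoid_topLe (k : ℕ) : IsClonoid Proj (MU01 k) (at1 All false ∪ Const) := by
  convert isClonoid_Increasing k (ρ := fun _ a _ => a = ⊤) (by rintro m n σ _ b rfl; rfl) using 1
  ext f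
  constructor
  · rintro (⟨-, h⟩ | h) a b rfl
    · rw [h]; exact Bool.false_le _
    · exact (h _ _).le
  · intro h
    cases hb : f.val ⊤
    · exact Or.inl ⟨trivial, hb⟩
    · have : ∀ a, f.val a = true := fun a => Bool.le_iff_imp.1 (h ⊤ a rfl) hb
      exact Or.inr fun a b => (this a).trans (this b).symm

theorem isClonoid_leBot (k : ℕ) : IsClonoid Proj (MU01 k) (at0 All true ∪ Const) := by
  convert isClonoid_Increasing k (ρ := fun _ _ b => b = ⊥) (by rintro m n σ a _ rfl; rfl) using 1
  ext f
  constructor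
  · rintro (⟨-, h⟩ | h) a b rfl
    · rw [h]; exact Bool.le_true _
    · exact (h _ _).le
  · intro h
    cases hb : f.val ⊥
    · have : ∀ a, f.val a = false := fun a =>
        le_antisymm ((h a ⊥ rfl).trans hb.le) (Bool.false_le _)
      exact Or.inr fun a b => (this a).trans (this b).symm
    · exact Or.inl ⟨trivial, hb⟩

theorem isClonoid_leTop (k : ℕ) : IsClonoid Proj (MU01 k) (at1 All true ∪ Const) := by
  convert isClonoid_Increasing k (ρ := fun _ _ b => b = ⊤) (by rintro m n σ a _ rfl; rfl) using 1
  ext f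
  constructor
  · rintro (⟨-, h⟩ | h) a b rfl
    · rw [h]; exact Bool.le_true _
    · exact (h _ _).le
  · intro h
    cases hb : f.val ⊤
    · have : ∀ a, f.val a = false := fun a =>
        le_antisymm ((h a ⊤ rfl).trans hb.le) (Bool.false_le _)
      exact Or.inr fun a b => (this a).trans (this b).symm
    · exact Or.inl ⟨trivial, hb⟩

theorem isClonoid_OmLe (k : ℕ) : IsClonoid Proj (MU01 k) OmLe := by
  convert isClonoid_Increasing k (ρ := fun _ a b => a = ⊥ ∧ b = ⊤)
    (by rintro m n σ _ _ ⟨rfl, rfl⟩; exact ⟨rfl, rfl⟩) using 1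
  ext f
  exact ⟨by rintro h a b ⟨rfl, rfl⟩; exact h, fun h => h _ _ ⟨rfl, rfl⟩⟩

theorem isClonoid_OmGe (k : ℕ) : IsClonoid Proj (MU01 k) OmGe := by
  convert isClonoid_Increasing k (ρ := fun _ a b => a = ⊤ ∧ b = ⊥)
    (by rintro m n σ _ _ ⟨rfl, rfl⟩; exact ⟨rfl, rfl⟩) using 1
  ext f
  exact ⟨by rintro h a b ⟨rfl, rfl⟩; exact h, fun h => h _ _ ⟨rfl, rfl⟩⟩

theorem isClonoid_Const (k : ℕ) : IsClonoid Proj (MU01 k) Const := by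
  convert isClonoid_Increasing k (ρ := fun _ _ _ => True) (fun _ _ _ h => h) using 1
  ext f
  exact ⟨fun h a b _ => (h a b).le, fun h a b => le_antisymm (h a b trivial) (h b a trivial)⟩

theorem isClonoid_Mon (k : ℕ) : IsClonoid Proj (MU01 k) Mon := by
  convert isClonoid_Increasing k (ρ := fun _ a b => a ≤ b) (fun σ _ _ h i => h (σ i)) using 1
  ext f
  exact ⟨fun h a b hab => h hab, fun h a b hab => h a b hab⟩

theorem isClonoid_negClass_Mon (k : ℕ) : IsClonoid Proj (MU01 k) (negClass Mon) := by
  convert isClonoid_Increasing k (ρ := fun _ a b => b ≤ a) (fun σ _ _ h i => h (σ i)) using 1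
  ext f
  rw [mem_negClass_Mon]
  exact ⟨fun h a b hab => h hab, fun h a b hab => h b a hab⟩

theorem isClonoid_Refl (k : ℕ) : IsClonoid Proj (MU01 k) Refl := by
  convert isClonoid_Increasing k (ρ := fun _ a b => b = fun i => !a i)
    (by rintro m n σ a _ rfl; rfl) using 1
  ext f
  constructor
  · rintro h a b rfl
    exact (h a).le
  · intro h a
    exact le_antisymm (h _ _ rfl) (h _ _ (by simp))

theorem IsClonoid.restrict_at0 {k : ℕ} {K : Set BoolFun}
    (hK : IsClonoid Proj (MU01 k) K) (c : Bool) :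
    IsClonoid Proj (MU01 k) (at0 K c) := by
  convert hK.inter (isClonoid_at0_All k c) using 1
  ext f; simp [mem_at0, mem_All]

theorem IsClonoid.restrict_at1 {k : ℕ} {K : Set BoolFun}
    (hK : IsClonoid Proj (MU01 k) K) (c : Bool) :
    IsClonoid Proj (MU01 k) (at1 K c) := by
  convert hK.inter (isClonoid_at1_All k c) using 1
  ext f; simp [mem_at1, mem_All]

theorem IsClonoid.restrict_at01 {k : ℕ} {K : Set BoolFun}
    (hK : IsClonoid Proj (MU01 k) K) (c d : Bool) :
    IsClonoid Proj (MU01 k) (at01 K c d) := (hK.restrict_at0 c).inter (hK.restrict_at1 d)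

theorem isClonoid_Om (k : ℕ) (c d : Bool) : IsClonoid Proj (MU01 k) (Om c d) :=
  (isClonoid_at0_All k c).inter (isClonoid_at1_All k d)

theorem isClonoid_negClass_at0 (k : ℕ) (c : Bool) :
    IsClonoid Proj (MU01 k) (negClass (at0 Mon c)) := by
  convert (isClonoid_negClass_Mon k).restrict_at0 (!c) using 1
  ext f; rw [mem_negClass_at0, mem_at0]

theorem isClonoid_negClass_at1 (k : ℕ) (c : Bool) :
    IsClonoid Proj (MU01 k) (negClass (at1 Mon c)) := by
  convert (isClonoid_negClass_Mon k).restrict_at1 (!c) using 1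
  ext f; rw [mem_negClass_at1, mem_at1]

theorem isClonoid_negClass_at01 (k : ℕ) (c d : Bool) :
    IsClonoid Proj (MU01 k) (negClass (at01 Mon c d)) := by
  convert (isClonoid_negClass_Mon k).restrict_at01 (!c) (!d) using 1
  ext f; rw [mem_negClass_at01, mem_at01]

theorem isClonoid_Om00_union_Const (k : ℕ) : IsClonoid Proj (MU01 k) (Om false false ∪ Const) := by
  convert (isClonoid_botLe k).inter (isClonoid_topLe k) using 1
  ext f
  rw [Set.mem_inter_iff, mem_Om_0_0_union_Const_iff, mem_at0_All_0_union_Const_iff,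
    mem_at1_All_0_union_Const_iff]
  cases kind f <;> simp

theorem isClonoid_Om01_union_Const (k : ℕ) : IsClonoid Proj (MU01 k) (Om false true ∪ Const) := by
  convert (isClonoid_botLe k).inter (isClonoid_leTop k) using 1
  ext f
  rw [Set.mem_inter_iff, mem_Om_0_1_union_Const_iff, mem_at0_All_0_union_Const_iff,
    mem_at1_All_1_union_Const_iff]
  cases kind f <;> simp

theorem isClonoid_Om10_union_Const (k : ℕ) : IsClonoid Proj (MU01 k) (Om true false ∪ Const) := by
  convert (isClonoid_leBot k).inter (isClonoid_topLe k) using 1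
  ext f
  rw [Set.mem_inter_iff, mem_Om_1_0_union_Const_iff, mem_at0_All_1_union_Const_iff,
    mem_at1_All_0_union_Const_iff]
  cases kind f <;> simp

theorem isClonoid_Om11_union_Const (k : ℕ) : IsClonoid Proj (MU01 k) (Om true true ∪ Const) := by
  convert (isClonoid_leBot k).inter (isClonoid_leTop k) using 1
  ext f
  rw [Set.mem_inter_iff, mem_Om_1_1_union_Const_iff, mem_at0_All_1_union_Const_iff,
    mem_at1_All_1_union_Const_iff]
  cases kind f <;> simp

theorem isClonoid_Om01_union_Const1 (k : ℕ) :
    IsClonoid Proj (MU01 k) (Om false true ∪ Const1) := by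
  convert (isClonoid_Om01_union_Const k).inter (isClonoid_at1_All k true) using 1
  ext f
  rw [Set.mem_inter_iff, mem_Om_0_1_union_Const1_iff, mem_Om_0_1_union_Const_iff,
    mem_at1_All_1_iff]
  cases kind f <;> simp

theorem isClonoid_Om10_union_Const1 (k : ℕ) :
    IsClonoid Proj (MU01 k) (Om true false ∪ Const1) := by
  convert (isClonoid_Om10_union_Const k).inter (isClonoid_at0_All k true) using 1
  ext f
  rw [Set.mem_inter_iff, mem_Om_1_0_union_Const1_iff, mem_Om_1_0_union_Const_iff,
    mem_at0_All_1_iff]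
  cases kind f <;> simp

theorem isClonoid_Om01_union_Const0 (k : ℕ) :
    IsClonoid Proj (MU01 k) (Om false true ∪ Const0) := by
  convert (isClonoid_Om01_union_Const k).inter (isClonoid_at0_All k false) using 1
  ext f
  rw [Set.mem_inter_iff, mem_Om_0_1_union_Const0_iff, mem_Om_0_1_union_Const_iff, mem_at0,
    kind_bot]
  cases kind f <;> simp [Kind.bot, mem_All]

theorem isClonoid_Om10_union_Const0 (k : ℕ) :
    IsClonoid Proj (MU01 k) (Om true false ∪ Const0) := by
  convert (isClonoid_Om10_union_Const k).inter (isClonoid_at1_All k false) using 1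
  ext f
  rw [Set.mem_inter_iff, mem_Om_1_0_union_Const0_iff, mem_Om_1_0_union_Const_iff, mem_at1,
    kind_top]
  cases kind f <;> simp [Kind.top, mem_All]

theorem isClonoid_Refl00_union_Const (k : ℕ) :
    IsClonoid Proj (MU01 k) (at01 Refl false false ∪ Const) := by
  convert (isClonoid_Refl k).inter (isClonoid_botLe k) using 1
  ext f
  rw [Set.mem_inter_iff, mem_at01_Refl_0_0_union_Const_iff, mem_Refl_iff,
    mem_at0_All_0_union_Const_iff]
  cases kind f <;> simp

theorem isClonoid_Refl11_union_Const (k : ℕ) :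
    IsClonoid Proj (MU01 k) (at01 Refl true true ∪ Const) := by
  convert (isClonoid_Refl k).inter (isClonoid_leBot k) using 1
  ext f
  rw [Set.mem_inter_iff, mem_at01_Refl_1_1_union_Const_iff, mem_Refl_iff,
    mem_at0_All_1_union_Const_iff]
  cases kind f <;> simp

theorem isClonoid_OmEq (k : ℕ) : IsClonoid Proj (MU01 k) OmEq := by
  convert (isClonoid_OmLe k).inter (isClonoid_OmGe k) using 1
  ext f
  rw [Set.mem_inter_iff, mem_OmEq_iff, mem_OmLe_iff, mem_OmGe_iff]
  cases kind f <;> simp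

/-! ### Kinds and membership in clonoids -/

theorem IsClonoid.exists_arity {C K : Set BoolFun} (hK : IsClonoid Proj C K) {f : BoolFun}
    (hf : f ∈ K) (n : ℕ+) :
    ∃ u : BF n, (⟨n, u⟩ : BoolFun) ∈ K ∧ u ⊥ = f.val ⊥ ∧ u ⊤ = f.val ⊤ := by
  obtain ⟨m, f⟩ := f
  exact ⟨_, hK.minor_mem hf fun _ => ⟨0, n.pos⟩, rfl, rfl⟩

theorem val_eq_of_kind_const0 {f : BoolFun} (h : kind f = .const0) (a : Fin f.arity → Bool) :
    f.val a = false := by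
  have hb := kind_bot f
  rw [h] at hb
  exact ((mem_Const_iff f).2 (Or.inl h) a ⊥).trans hb

theorem val_eq_of_kind_const1 {f : BoolFun} (h : kind f = .const1) (a : Fin f.arity → Bool) :
    f.val a = true := by
  have hb := kind_bot f
  rw [h] at hb
  exact ((mem_Const_iff f).2 (Or.inr h) a ⊥).trans hb

theorem exists_true_of_kind {f : BoolFun} (h : kind f ≠ .const0) : ∃ a, f.val a = true := by
  by_contra! h'
  have h0 : ∀ a, f.val a = false := fun a => Bool.eq_false_iff.2 (h' a)
  have hb := h0 ⊥
  rw [kind_bot] at hb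
  rcases (mem_Const_iff f).1 fun a b => (h0 a).trans (h0 b).symm with h1 | h1
  · exact h h1
  · rw [h1] at hb; cases hb

/-- Some member of `K` has minors that separate all pairs of points with the letters
`o, i, x, y`. -/
def SepBy (K : Set BoolFun) (o i x y : Prop) : Prop := ∃ g ∈ K, (kind g).Sep o i x y

/-- A function with true points belongs to `K` as soon as every pair of points that may have to be
separated for functions of its kind is separated by minors of members of `K`. -/
theorem IsClonoid.mem_of_kind {k : ℕ} (hk : 1 ≤ k) {K : Set BoolFun}
    (hK : IsClonoid Proj (MU01 k) K) {f : BoolFun} (hf : f ∈ UTheta k (lowerPart k K))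
    (hc : kind f ≠ .const0)
    (h : ∀ o i x y, (kind f).Req o i x y → SepBy K o i x y) : f ∈ K := by
  refine hK.mem_of_mem_UTheta hk hf (fun a b ha hb => ?_) (exists_true_of_kind hc)
  obtain ⟨g, hg, hs⟩ := h _ _ _ _ (req_of_kind ha hb)
  exact hK.separates_of_kind hg hs
/-- The constant `0` is the meet of minors of a member that vanishes at `⊥` and of one that
vanishes at `⊤`. -/
theorem IsClonoid.const0_mem {k : ℕ} (hk : 1 ≤ k) {K : Set BoolFun}
    (hK : IsClonoid Proj (MU01 k) K) {f₁ f₂ g : BoolFun} (hf₁ : f₁ ∈ K) (hb : f₁.val ⊥ = false)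
    (hf₂ : f₂ ∈ K) (ht : f₂.val ⊤ = false) (hg : kind g = .const0) : g ∈ K := by
  have hval := val_eq_of_kind_const0 hg
  obtain ⟨n, g⟩ := g
  refine hK.mem_of_separates hk ?_ ?_ ?_
  · intro T hT _
    obtain ⟨u, hu, -⟩ := hK.exists_arity hf₁ n
    exact ⟨u, hu, fun a ha => absurd ((hval a).symm.trans (hT a ha)) (by decide)⟩
  · intro a b ha
    exact absurd ((hval a).symm.trans ha) (by decide)
  · intro b _
    obtain ⟨m₁, f₁⟩ := f₁
    obtain ⟨m₂, f₂⟩ := f₂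
    cases h : b ⟨0, n.pos⟩
    · refine ⟨_, hK.minor_mem hf₁ fun _ => ⟨0, n.pos⟩, ?_⟩
      rw [← hb]
      exact congrArg f₁ (funext fun _ => h)
    · refine ⟨_, hK.minor_mem hf₂ fun _ => ⟨0, n.pos⟩, ?_⟩
      rw [← ht]
      exact congrArg f₂ (funext fun _ => h)

theorem IsClonoid.mem_UTheta_of_const1 {C K : Set BoolFun} (hK : IsClonoid Proj C K) (k : ℕ)
    {g : BoolFun} (hg : g ∈ K) (hb : g.val ⊥ = true) (ht : g.val ⊤ = true) (f : BoolFun) :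
    f ∈ UTheta k (lowerPart k K) := by
  have h1 : (⟨f.arity, fun _ => true⟩ : BoolFun) ∈ K := hK.const_mem hg hb ht fun _ => rfl
  intro T hT hcard
  classical
  refine ⟨⟨f.arity, fun a => decide (a ∈ T)⟩, ⟨by simpa [AllLE] using hcard, _, h1, ⟨?_⟩⟩, id,
    fun a ha => by simpa using ha⟩
  exact fun _ => Bool.le_true _

/-- `K` has a member of kind `κ`. -/
def HasKind (K : Set BoolFun) (κ : Kind) : Prop := ∃ g ∈ K, kind g = κ

theorem HasKind.sepBy {K : Set BoolFun} {κ : Kind} (h : HasKind K κ) {o i x y : Prop}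
    (hs : κ.Sep o i x y) : SepBy K o i x y := by
  obtain ⟨g, hg, rfl⟩ := h
  exact ⟨g, hg, hs⟩

theorem sepBy_of_mono_or_up {K : Set BoolFun} (h : HasKind K .mono ∨ HasKind K .up)
    (o i x y : Prop) (hs : y) : SepBy K o i x y := by
  rcases h with h | h
  · exact h.sepBy hs
  · exact h.sepBy (Or.inl hs)

theorem sepBy_of_anti_or_down {K : Set BoolFun} (h : HasKind K .anti ∨ HasKind K .down)
    (o i x y : Prop) (hs : x) : SepBy K o i x y := by
  rcases h with h | h
  · exact h.sepBy hs
  · exact h.sepBy (Or.inl hs)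

theorem sepBy_of_refl0_or_eq0 {K : Set BoolFun} (h : HasKind K .refl0 ∨ HasKind K .eq0)
    (o i x y : Prop) (hs : o ∧ y ∨ x ∧ i) : SepBy K o i x y := by
  rcases h with h | h
  · exact h.sepBy hs
  · exact h.sepBy (hs.imp id Or.inl)

theorem sepBy_of_refl1_or_eq1 {K : Set BoolFun} (h : HasKind K .refl1 ∨ HasKind K .eq1)
    (o i x y : Prop) (hs : o ∧ x ∨ i ∧ y) : SepBy K o i x y := by
  rcases h with h | h
  · exact h.sepBy hs
  · exact h.sepBy (hs.imp id Or.inl)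

/-! ### Clonoids containing the constant `1` -/

set_option maxHeartbeats 4000000 in
/-- The clonoids containing the constant `1` are unions of kinds, since `SepBy` depends only on
which kinds occur. -/
theorem IsClonoid.eq_of_const1_mem {k : ℕ} (hk : 1 ≤ k) {K : Set BoolFun}
    (hK : IsClonoid Proj (MU01 k) K) (h1 : ∃ g ∈ K, g.val ⊥ = true ∧ g.val ⊤ = true) :
    K = Set.univ ∨ K ∈ ({OmLe, OmGe, OmEq,
        at0 All false ∪ Const, at1 All false ∪ Const,
        at0 All true ∪ Const, at1 All true ∪ Const,
        Om false false ∪ Const, Om false true ∪ Const, Om true false ∪ Const,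
        Om true true ∪ Const,
        Om false true ∪ Const1, Om true false ∪ Const1,
        at0 All true, at1 All true,
        Om true true,
        Mon, at1 Mon true, negClass Mon, negClass (at0 Mon false),
        Refl, at01 Refl false false ∪ Const, at01 Refl true true ∪ Const,
        at01 Refl true true,
        Const, Const1} : Set (Set BoolFun)) := by
  obtain ⟨g₁, hg₁, hb₁, ht₁⟩ := h1
  -- All functions of kind `κ` belong to `K` once the pairs they may require are separated.
  have fill : ∀ κ : Kind, κ ≠ .const0 → (∀ o i x y, κ.Req o i x y → SepBy K o i x y) →
      ∀ f, kind f = κ → f ∈ K := by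
    rintro κ hκ h f rfl
    exact hK.mem_of_kind hk (hK.mem_UTheta_of_const1 k hg₁ hb₁ ht₁ f) hκ h
  have F1 : ∀ f, kind f = .const1 → f ∈ K := fun f hf =>
    hK.const_mem hg₁ hb₁ ht₁ (val_eq_of_kind_const1 hf)
  have hkind : ∀ f ∈ K, HasKind K (kind f) := fun f hf => ⟨f, hf, rfl⟩
  have F0 : HasKind K .const0 → ∀ f, kind f = .const0 → f ∈ K := by
    rintro ⟨g, hg, hgk⟩ f hf
    exact hK.const0_mem hk hg (by rw [kind_bot, hgk]; rfl) hg (by rw [kind_top, hgk]; rfl) hf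
  have F0' : HasKind K .refl0 ∨ HasKind K .eq0 → ∀ f, kind f = .const0 → f ∈ K := by
    rintro (⟨g, hg, hgk⟩ | ⟨g, hg, hgk⟩) f hf <;>
      exact hK.const0_mem hk hg (by rw [kind_bot, hgk]; rfl) hg (by rw [kind_top, hgk]; rfl) hf
  -- Which kinds with `f ⊥ < f ⊤`, `f ⊥ > f ⊤`, `f ⊥ = f ⊤ = 0`, `f ⊥ = f ⊤ = 1` occur decides the
  -- class up to the presence of `const0`, `up`, `down`, `eq0` and `eq1`.
  by_cases h01 : HasKind K .mono ∨ HasKind K .up <;>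
    by_cases h10 : HasKind K .anti ∨ HasKind K .down
  · have s01 := sepBy_of_mono_or_up h01
    have s10 := sepBy_of_anti_or_down h10
    left
    have F0 : ∀ f, kind f = .const0 → f ∈ K := by
      rcases h01 with ⟨g, hg, hgk⟩ | ⟨g, hg, hgk⟩ <;>
      rcases h10 with ⟨g', hg', hgk'⟩ | ⟨g', hg', hgk'⟩ <;>
      exact fun f => hK.const0_mem hk hg (by rw [kind_bot, hgk]; rfl) hg'
        (by rw [kind_top, hgk']; rfl)
    refine Set.eq_univ_of_forall fun f => ?_
    cases hκ : kind f
    case const0 => exact F0 f hκ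
    case const1 => exact F1 f hκ
    all_goals
      refine fill _ (by simp) (fun o i x y => ?_) f hκ
      simp only [Kind.Req]
      grind
  · have s01 := sepBy_of_mono_or_up h01
    have Fmono := fill .mono (by simp) fun o i x y h => s01 o i x y h
    by_cases h00 : HasKind K .refl0 ∨ HasKind K .eq0 <;>
      by_cases h11 : HasKind K .refl1 ∨ HasKind K .eq1
    · have s00 := sepBy_of_refl0_or_eq0 h00
      have s11 := sepBy_of_refl1_or_eq1 h11
      have F0 := F0' h00
      have Fup := fill .up (by simp) fun o i x y => by simp only [Kind.Req]; grind
      have Frefl0 := fill .refl0 (by simp) fun o i x y => by simp only [Kind.Req]; grind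
      have Feq0 := fill .eq0 (by simp) fun o i x y => by simp only [Kind.Req]; grind
      have Frefl1 := fill .refl1 (by simp) fun o i x y => by simp only [Kind.Req]; grind
      have Feq1 := fill .eq1 (by simp) fun o i x y => by simp only [Kind.Req]; grind
      have : K = OmLe := by ext f; rw [mem_OmLe_iff]; cases hκ : kind f <;> grind
      simp only [this, Set.mem_insert_iff, Set.mem_singleton_iff, true_or, or_true]
    · have s00 := sepBy_of_refl0_or_eq0 h00
      have F0 := F0' h00
      have Fup := fill .up (by simp) fun o i x y => by simp only [Kind.Req]; grind
      have Frefl0 := fill .refl0 (by simp) fun o i x y => by simp only [Kind.Req]; grind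
      have Feq0 := fill .eq0 (by simp) fun o i x y => by simp only [Kind.Req]; grind
      have : K = at0 All false ∪ Const := by
        ext f; rw [mem_at0_All_0_union_Const_iff]; cases hκ : kind f <;> grind
      simp only [this, Set.mem_insert_iff, Set.mem_singleton_iff, true_or, or_true]
    · have s11 := sepBy_of_refl1_or_eq1 h11
      have Fup := fill .up (by simp) fun o i x y => by simp only [Kind.Req]; grind
      have Frefl1 := fill .refl1 (by simp) fun o i x y => by simp only [Kind.Req]; grind
      have Feq1 := fill .eq1 (by simp) fun o i x y => by simp only [Kind.Req]; grind
      by_cases h0 : HasKind K .const0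
      · have F0 := F0 h0
        have : K = at1 All true ∪ Const := by
          ext f; rw [mem_at1_All_1_union_Const_iff]; cases hκ : kind f <;> grind
        simp only [this, Set.mem_insert_iff, Set.mem_singleton_iff, true_or, or_true]
      · have : K = at1 All true := by ext f; rw [mem_at1_All_1_iff]; cases hκ : kind f <;> grind
        simp only [this, Set.mem_insert_iff, Set.mem_singleton_iff, true_or, or_true]
    · by_cases hup : HasKind K .up
      · have sup := fun o i x y => hup.sepBy (o := o) (i := i) (x := x) (y := y)
        simp only [Kind.Sep] at sup
        have Fup := fill .up (by simp) fun o i x y => by simp only [Kind.Req]; grind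
        by_cases h0 : HasKind K .const0
        · have F0 := F0 h0
          have : K = Om false true ∪ Const := by
            ext f; rw [mem_Om_0_1_union_Const_iff]; cases hκ : kind f <;> grind
          simp only [this, Set.mem_insert_iff, Set.mem_singleton_iff, true_or, or_true]
        · have : K = Om false true ∪ Const1 := by
            ext f; rw [mem_Om_0_1_union_Const1_iff]; cases hκ : kind f <;> grind
          simp only [this, Set.mem_insert_iff, Set.mem_singleton_iff, true_or, or_true]
      · by_cases h0 : HasKind K .const0
        · have F0 := F0 h0
          have : K = Mon := by ext f; rw [mem_Mon_iff]; cases hκ : kind f <;> grind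
          simp only [this, Set.mem_insert_iff, Set.mem_singleton_iff, true_or, or_true]
        · have : K = at1 Mon true := by ext f; rw [mem_at1_Mon_1_iff]; cases hκ : kind f <;> grind
          simp only [this, Set.mem_insert_iff, Set.mem_singleton_iff, true_or, or_true]
  · have s10 := sepBy_of_anti_or_down h10
    have Fanti := fill .anti (by simp) fun o i x y h => s10 o i x y h
    by_cases h00 : HasKind K .refl0 ∨ HasKind K .eq0 <;>
      by_cases h11 : HasKind K .refl1 ∨ HasKind K .eq1
    · have s00 := sepBy_of_refl0_or_eq0 h00
      have s11 := sepBy_of_refl1_or_eq1 h11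
      have F0 := F0' h00
      have Fup := fill .down (by simp) fun o i x y => by simp only [Kind.Req]; grind
      have Frefl0 := fill .refl0 (by simp) fun o i x y => by simp only [Kind.Req]; grind
      have Feq0 := fill .eq0 (by simp) fun o i x y => by simp only [Kind.Req]; grind
      have Frefl1 := fill .refl1 (by simp) fun o i x y => by simp only [Kind.Req]; grind
      have Feq1 := fill .eq1 (by simp) fun o i x y => by simp only [Kind.Req]; grind
      have : K = OmGe := by ext f; rw [mem_OmGe_iff]; cases hκ : kind f <;> grind
      simp only [this, Set.mem_insert_iff, Set.mem_singleton_iff, true_or, or_true]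
    · have s00 := sepBy_of_refl0_or_eq0 h00
      have F0 := F0' h00
      have Fup := fill .down (by simp) fun o i x y => by simp only [Kind.Req]; grind
      have Frefl0 := fill .refl0 (by simp) fun o i x y => by simp only [Kind.Req]; grind
      have Feq0 := fill .eq0 (by simp) fun o i x y => by simp only [Kind.Req]; grind
      have : K = at1 All false ∪ Const := by
        ext f; rw [mem_at1_All_0_union_Const_iff]; cases hκ : kind f <;> grind
      simp only [this, Set.mem_insert_iff, Set.mem_singleton_iff, true_or, or_true]
    · have s11 := sepBy_of_refl1_or_eq1 h11
      have Fup := fill .down (by simp) fun o i x y => by simp only [Kind.Req]; grind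
      have Frefl1 := fill .refl1 (by simp) fun o i x y => by simp only [Kind.Req]; grind
      have Feq1 := fill .eq1 (by simp) fun o i x y => by simp only [Kind.Req]; grind
      by_cases h0 : HasKind K .const0
      · have F0 := F0 h0
        have : K = at0 All true ∪ Const := by
          ext f; rw [mem_at0_All_1_union_Const_iff]; cases hκ : kind f <;> grind
        simp only [this, Set.mem_insert_iff, Set.mem_singleton_iff, true_or, or_true]
      · have : K = at0 All true := by ext f; rw [mem_at0_All_1_iff]; cases hκ : kind f <;> grind
        simp only [this, Set.mem_insert_iff, Set.mem_singleton_iff, true_or, or_true]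
    · by_cases hup : HasKind K .down
      · have sup := fun o i x y => hup.sepBy (o := o) (i := i) (x := x) (y := y)
        simp only [Kind.Sep] at sup
        have Fup := fill .down (by simp) fun o i x y => by simp only [Kind.Req]; grind
        by_cases h0 : HasKind K .const0
        · have F0 := F0 h0
          have : K = Om true false ∪ Const := by
            ext f; rw [mem_Om_1_0_union_Const_iff]; cases hκ : kind f <;> grind
          simp only [this, Set.mem_insert_iff, Set.mem_singleton_iff, true_or, or_true]
        · have : K = Om true false ∪ Const1 := by
            ext f; rw [mem_Om_1_0_union_Const1_iff]; cases hκ : kind f <;> grind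
          simp only [this, Set.mem_insert_iff, Set.mem_singleton_iff, true_or, or_true]
      · by_cases h0 : HasKind K .const0
        · have F0 := F0 h0
          have : K = negClass Mon := by
            ext f; rw [mem_negClass_Mon_iff]; cases hκ : kind f <;> grind
          simp only [this, Set.mem_insert_iff, Set.mem_singleton_iff, true_or, or_true]
        · have : K = negClass (at0 Mon false) := by
            ext f; rw [mem_negClass_at0_Mon_0_iff]; cases hκ : kind f <;> grind
          simp only [this, Set.mem_insert_iff, Set.mem_singleton_iff, true_or, or_true]
  · by_cases h00 : HasKind K .refl0 ∨ HasKind K .eq0 <;>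
      by_cases h11 : HasKind K .refl1 ∨ HasKind K .eq1
    · have s00 := sepBy_of_refl0_or_eq0 h00
      have F0 := F0' h00
      have Frefl0 := fill .refl0 (by simp) fun o i x y => by simp only [Kind.Req]; grind
      have s11 := sepBy_of_refl1_or_eq1 h11
      have Frefl1 := fill .refl1 (by simp) fun o i x y => by simp only [Kind.Req]; grind
      by_cases he0 : HasKind K .eq0
      · have seq0 := fun o i x y => he0.sepBy (o := o) (i := i) (x := x) (y := y)
        simp only [Kind.Sep] at seq0
        have Feq0 := fill .eq0 (by simp) fun o i x y => by simp only [Kind.Req]; grind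
        have Feq1 := fill .eq1 (by simp) fun o i x y => by simp only [Kind.Req]; grind
        have : K = OmEq := by ext f; rw [mem_OmEq_iff]; cases hκ : kind f <;> grind
        simp only [this, Set.mem_insert_iff, Set.mem_singleton_iff, true_or, or_true]
      by_cases he1 : HasKind K .eq1
      · have seq1 := fun o i x y => he1.sepBy (o := o) (i := i) (x := x) (y := y)
        simp only [Kind.Sep] at seq1
        have Feq1 := fill .eq1 (by simp) fun o i x y => by simp only [Kind.Req]; grind
        have Feq0 := fill .eq0 (by simp) fun o i x y => by simp only [Kind.Req]; grind
        have : K = OmEq := by ext f; rw [mem_OmEq_iff]; cases hκ : kind f <;> grind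
        simp only [this, Set.mem_insert_iff, Set.mem_singleton_iff, true_or, or_true]
      have : K = Refl := by ext f; rw [mem_Refl_iff]; cases hκ : kind f <;> grind
      simp only [this, Set.mem_insert_iff, Set.mem_singleton_iff, true_or, or_true]
    · have s00 := sepBy_of_refl0_or_eq0 h00
      have F0 := F0' h00
      have Frefl0 := fill .refl0 (by simp) fun o i x y => by simp only [Kind.Req]; grind
      by_cases he0 : HasKind K .eq0
      · have seq0 := fun o i x y => he0.sepBy (o := o) (i := i) (x := x) (y := y)
        simp only [Kind.Sep] at seq0
        have Feq0 := fill .eq0 (by simp) fun o i x y => by simp only [Kind.Req]; grind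
        have : K = Om false false ∪ Const := by
          ext f; rw [mem_Om_0_0_union_Const_iff]; cases hκ : kind f <;> grind
        simp only [this, Set.mem_insert_iff, Set.mem_singleton_iff, true_or, or_true]
      · have : K = at01 Refl false false ∪ Const := by
          ext f; rw [mem_at01_Refl_0_0_union_Const_iff]; cases hκ : kind f <;> grind
        simp only [this, Set.mem_insert_iff, Set.mem_singleton_iff, true_or, or_true]
    · have s11 := sepBy_of_refl1_or_eq1 h11
      have Frefl1 := fill .refl1 (by simp) fun o i x y => by simp only [Kind.Req]; grind
      by_cases he1 : HasKind K .eq1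
      · have seq1 := fun o i x y => he1.sepBy (o := o) (i := i) (x := x) (y := y)
        simp only [Kind.Sep] at seq1
        have Feq1 := fill .eq1 (by simp) fun o i x y => by simp only [Kind.Req]; grind
        by_cases h0 : HasKind K .const0
        · have F0 := F0 h0
          have : K = Om true true ∪ Const := by
            ext f; rw [mem_Om_1_1_union_Const_iff]; cases hκ : kind f <;> grind
          simp only [this, Set.mem_insert_iff, Set.mem_singleton_iff, true_or, or_true]
        · have : K = Om true true := by ext f; rw [mem_Om_1_1_iff]; cases hκ : kind f <;> grind
          simp only [this, Set.mem_insert_iff, Set.mem_singleton_iff, true_or, or_true]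
      · by_cases h0 : HasKind K .const0
        · have F0 := F0 h0
          have : K = at01 Refl true true ∪ Const := by
            ext f; rw [mem_at01_Refl_1_1_union_Const_iff]; cases hκ : kind f <;> grind
          simp only [this, Set.mem_insert_iff, Set.mem_singleton_iff, true_or, or_true]
        · have : K = at01 Refl true true := by
            ext f; rw [mem_at01_Refl_1_1_iff]; cases hκ : kind f <;> grind
          simp only [this, Set.mem_insert_iff, Set.mem_singleton_iff, true_or, or_true]
    · by_cases h0 : HasKind K .const0
      · have F0 := F0 h0
        have : K = Const := by ext f; rw [mem_Const_iff]; cases hκ : kind f <;> grind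
        simp only [this, Set.mem_insert_iff, Set.mem_singleton_iff, true_or, or_true]
      · have : K = Const1 := by ext f; rw [mem_Const1_iff]; cases hκ : kind f <;> grind
        simp only [this, Set.mem_insert_iff, Set.mem_singleton_iff, or_true]

/-! ### Clonoids without the constant `1` -/

theorem IsClonoid.exists_mem_of_mem_UTheta {k : ℕ} (hk : 2 ≤ k) {C K : Set BoolFun}
    (hK : IsClonoid Proj C K) {f : BoolFun} (hf : f ∈ UTheta k (lowerPart k K))
    (a b : Fin f.arity → Bool) :
    ∃ g : BF f.arity, (⟨f.arity, g⟩ : BoolFun) ∈ K ∧ (f.val a = true → g a = true) ∧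
      (f.val b = true → g b = true) := by
  classical
  obtain ⟨⟨m, θ⟩, ⟨-, -, hg, ⟨hle⟩⟩, τ, hτ⟩ := hf (({a, b} : Finset _).filter (f.val · = true))
    (fun c hc => (Finset.mem_filter.1 hc).2)
    ((Finset.card_filter_le _ _).trans (Finset.card_le_two.trans hk))
  exact ⟨_, hK.minor_mem hg τ, fun ha => Bool.le_iff_imp.1 (hle _) (hτ a (by simp [ha])),
    fun hb => Bool.le_iff_imp.1 (hle _) (hτ b (by simp [hb]))⟩

/-- If `K` has a member with `f ⊥ = c`, `f ⊤ = d`, then every constant `0` in `K` has a majorant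
of the same arity in `K` with these values. -/
theorem IsClonoid.exists_majorant_of_const0 {C K : Set BoolFun} (hK : IsClonoid Proj C K)
    {f g : BoolFun} (hf : f ∈ K) (hg : kind g = .const0) :
    ∃ u ∈ K, (u.val ⊥ = f.val ⊥ ∧ u.val ⊤ = f.val ⊤) ∧ Minorant g u := by
  obtain ⟨u, hu, hb, ht⟩ := hK.exists_arity hf g.arity
  refine ⟨_, hu, ⟨hb, ht⟩, ⟨fun a => ?_⟩⟩
  rw [val_eq_of_kind_const0 hg]
  exact Bool.false_le _

set_option maxHeartbeats 2000000 in
/-- A clonoid `K` without the constant `1` is cut out from `UTheta k (lowerPart k K)` by the pairs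
of points that its members separate. -/
theorem IsClonoid.eq_of_const1_notMem {k : ℕ} (hk : 2 ≤ k) {K : Set BoolFun}
    (hK : IsClonoid Proj (MU01 k) K) (h1 : ¬∃ g ∈ K, g.val ⊥ = true ∧ g.val ⊤ = true) :
    (∃ Θ : Set BoolFun, IsIdealLE k MinMin Θ ∧ K = UTheta k Θ) ∨
    (∃ Θ : Set BoolFun, Θ.Nonempty ∧ IsIdealLE k (MinMinC (at1 All true)) Θ ∧
      (K = UTheta k Θ ∩ (Om false true ∪ Const0) ∨ K = UTheta k Θ ∩ Om false true)) ∨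
    (∃ Θ : Set BoolFun, Θ.Nonempty ∧ IsIdealLE k (MinMinC (at0 All true)) Θ ∧
      (K = UTheta k Θ ∩ (Om true false ∪ Const0) ∨ K = UTheta k Θ ∩ Om true false)) ∨
    (∃ Θ : Set BoolFun, Θ.Nonempty ∧ IsIdealLE k (MinMinC Mon) Θ ∧
      (K = UTheta k Θ ∩ at0 Mon false ∨ K = UTheta k Θ ∩ at01 Mon false true)) ∨
    (∃ Θ : Set BoolFun, Θ.Nonempty ∧ IsIdealLE k (MinMinC (negClass Mon)) Θ ∧
      (K = UTheta k Θ ∩ negClass (at1 Mon true) ∨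
        K = UTheta k Θ ∩ negClass (at01 Mon false true))) ∨
    (∃ Θ : Set BoolFun, Θ.Nonempty ∧ IsIdealLE k (MinMinC Refl) Θ ∧
      K = UTheta k Θ ∩ at01 Refl false false) := by
  have hk1 : 1 ≤ k := by omega
  have hKU := subset_UTheta_lowerPart k K
  -- As `UTheta` only covers true points, separation decides which of its members of kind `κ`
  -- belong to `K`.
  have fill : ∀ κ : Kind, κ ≠ .const0 → (∀ o i x y, κ.Req o i x y → SepBy K o i x y) →
      ∀ f ∈ UTheta k (lowerPart k K), kind f = κ → f ∈ K := by
    rintro κ hκ h f hf rfl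
    exact hK.mem_of_kind hk1 hf hκ h
  have hkind : ∀ f ∈ K, HasKind K (kind f) := fun f hf => ⟨f, hf, rfl⟩
  have K11 : ∀ f ∈ K, kind f ≠ .const1 ∧ kind f ≠ .refl1 ∧ kind f ≠ .eq1 := by
    intro f hf
    have := fun h => h1 ⟨f, hf, h⟩
    rw [kind_bot, kind_top] at this
    revert this
    cases kind f <;> simp [Kind.bot, Kind.top]
  -- Since `2 ≤ k`, the points `⊥` and `⊤` can be covered by a single member of `K`, so that the
  -- values at `⊥` and `⊤` of the functions in `UTheta` are limited by those of `K`.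
  have U11 : ∀ f ∈ UTheta k (lowerPart k K),
      kind f ≠ .const1 ∧ kind f ≠ .refl1 ∧ kind f ≠ .eq1 := by
    intro f hf
    obtain ⟨g, hg, hb, ht⟩ := hK.exists_mem_of_mem_UTheta hk hf ⊥ ⊤
    have := fun h h' => h1 ⟨_, hg, hb h, ht h'⟩
    rw [kind_bot, kind_top] at this
    revert this
    cases kind f <;> simp [Kind.bot, Kind.top]
  have U10 : ∀ f ∈ UTheta k (lowerPart k K), kind f = .anti ∨ kind f = .down →
      HasKind K .anti ∨ HasKind K .down := by
    intro f hf hfk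
    obtain ⟨g, hg, hb, -⟩ := hK.exists_mem_of_mem_UTheta hk hf ⊥ ⊥
    have hgb : (kind ⟨f.arity, g⟩).bot = true := by
      rw [← kind_bot]
      exact hb (by rw [kind_bot]; rcases hfk with h | h <;> rw [h] <;> rfl)
    have h2 := K11 _ hg
    have h3 := hkind _ hg
    revert hgb h2 h3
    cases kind ⟨f.arity, g⟩ <;> simp +contextual [Kind.bot]
  have U01 : ∀ f ∈ UTheta k (lowerPart k K), kind f = .mono ∨ kind f = .up →
      HasKind K .mono ∨ HasKind K .up := by
    intro f hf hfk
    obtain ⟨g, hg, ht, -⟩ := hK.exists_mem_of_mem_UTheta hk hf ⊤ ⊤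
    have hgt : (kind ⟨f.arity, g⟩).top = true := by
      rw [← kind_top]
      exact ht (by rw [kind_top]; rcases hfk with h | h <;> rw [h] <;> rfl)
    have h2 := K11 _ hg
    have h3 := hkind _ hg
    revert hgt h2 h3
    cases kind ⟨f.arity, g⟩ <;> simp +contextual [Kind.top]
  have F0 : HasKind K .const0 → ∀ f, kind f = .const0 → f ∈ K := by
    rintro ⟨g, hg, hgk⟩ f hf
    exact hK.const0_mem hk1 hg (by rw [kind_bot, hgk]; rfl) hg (by rw [kind_top, hgk]; rfl) hf
  have F0' : HasKind K .refl0 ∨ HasKind K .eq0 → ∀ f, kind f = .const0 → f ∈ K := by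
    rintro (⟨g, hg, hgk⟩ | ⟨g, hg, hgk⟩) f hf <;>
      exact hK.const0_mem hk1 hg (by rw [kind_bot, hgk]; rfl) hg (by rw [kind_top, hgk]; rfl) hf
  have hne : ∀ κ, HasKind K κ → (lowerPart k K).Nonempty := fun κ ⟨g, hg, _⟩ =>
    lowerPart_nonempty ⟨g, hg⟩
  have caseU : (∀ f ∈ UTheta k (lowerPart k K), f ∈ K) →
      ∃ Θ : Set BoolFun, IsIdealLE k MinMin Θ ∧ K = UTheta k Θ := fun h =>
    ⟨_, hK.isIdealLE_minMin k, hKU.antisymm h⟩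
  -- If `K ⊆ D`, then every member of `K` is its own majorant in `K ∩ D`.
  have hself : ∀ {D : Set BoolFun}, K ⊆ D → IsIdealLE k (MinMinC D) (lowerPart k K) :=
    fun hD => hK.isIdealLE_minMinC k fun g hg => ⟨g, hg, hD hg, ⟨le_rfl⟩⟩
  by_cases h01 : HasKind K .mono ∨ HasKind K .up <;>
    by_cases h10 : HasKind K .anti ∨ HasKind K .down
  · have s01 := sepBy_of_mono_or_up h01
    have s10 := sepBy_of_anti_or_down h10
    have F0 : ∀ f, kind f = .const0 → f ∈ K := by
      rcases h01 with ⟨g, hg, hgk⟩ | ⟨g, hg, hgk⟩ <;>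
      rcases h10 with ⟨g', hg', hgk'⟩ | ⟨g', hg', hgk'⟩ <;>
      exact fun f => hK.const0_mem hk1 hg (by rw [kind_bot, hgk]; rfl) hg'
        (by rw [kind_top, hgk']; rfl)
    refine Or.inl (caseU fun f hf => ?_)
    cases hκ : kind f
    case const0 => exact F0 f hκ
    case const1 => exact absurd hκ (U11 f hf).1
    all_goals
      refine fill _ (by simp) (fun o i x y => ?_) f hf hκ
      simp only [Kind.Req]
      grind
  all_goals by_cases h00 : HasKind K .refl0 ∨ HasKind K .eq0
  · have s01 := sepBy_of_mono_or_up h01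
    have s00 := sepBy_of_refl0_or_eq0 h00
    have F0 := F0' h00
    have Fmono := fill .mono (by simp) fun o i x y => by simp only [Kind.Req]; grind
    have Fup := fill .up (by simp) fun o i x y => by simp only [Kind.Req]; grind
    have Frefl0 := fill .refl0 (by simp) fun o i x y => by simp only [Kind.Req]; grind
    have Feq0 := fill .eq0 (by simp) fun o i x y => by simp only [Kind.Req]; grind
    refine Or.inl (caseU fun f hf => ?_)
    cases hκ : kind f <;> grind
  · have s01 := sepBy_of_mono_or_up h01
    have Fmono := fill .mono (by simp) fun o i x y => by simp only [Kind.Req]; grind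
    by_cases hup : HasKind K .up
    · have sup := fun o i x y => hup.sepBy (o := o) (i := i) (x := x) (y := y)
      simp only [Kind.Sep] at sup
      have Fup := fill .up (by simp) fun o i x y => by simp only [Kind.Req]; grind
      -- The constant `0` is not in `at1 All true`; it lies below the minors of a
      -- function of kind `up`.
      refine Or.inr (Or.inl ⟨lowerPart k K, hne _ hup, hK.isIdealLE_minMinC k fun g hg => ?_, ?_⟩)
      · by_cases hg0 : kind g = .const0
        · obtain ⟨f, hf, hfk⟩ := hup
          obtain ⟨u, hu, ⟨-, ht⟩, hgu⟩ := hK.exists_majorant_of_const0 hf hg0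
          exact ⟨u, hu, ⟨trivial, by rw [ht, kind_top, hfk]; rfl⟩, hgu⟩
        · refine ⟨g, hg, (mem_at1_All_1_iff g).2 ?_, ⟨le_rfl⟩⟩
          cases hκ : kind g <;> grind
      · by_cases h0 : HasKind K .const0
        · left
          ext f; rw [Set.mem_inter_iff, mem_Om_0_1_union_Const0_iff]
          cases hκ : kind f <;> grind
        · right
          ext f; rw [Set.mem_inter_iff, mem_Om_0_1_iff]
          cases hκ : kind f <;> grind
    · refine Or.inr (Or.inr (Or.inr (Or.inl
        ⟨lowerPart k K, hne _ (h01.resolve_right hup), hself fun g hg => ?_, ?_⟩)))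
      · rw [mem_Mon_iff]
        cases hκ : kind g <;> grind
      · by_cases h0 : HasKind K .const0
        · left
          ext f; rw [Set.mem_inter_iff, mem_at0_Mon_0_iff]
          cases hκ : kind f <;> grind
        · right
          ext f; rw [Set.mem_inter_iff, mem_at01_Mon_0_1_iff]
          cases hκ : kind f <;> grind
  · have s10 := sepBy_of_anti_or_down h10
    have s00 := sepBy_of_refl0_or_eq0 h00
    have F0 := F0' h00
    have Fanti := fill .anti (by simp) fun o i x y => by simp only [Kind.Req]; grind
    have Fdown := fill .down (by simp) fun o i x y => by simp only [Kind.Req]; grind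
    have Frefl0 := fill .refl0 (by simp) fun o i x y => by simp only [Kind.Req]; grind
    have Feq0 := fill .eq0 (by simp) fun o i x y => by simp only [Kind.Req]; grind
    refine Or.inl (caseU fun f hf => ?_)
    cases hκ : kind f <;> grind
  · have s10 := sepBy_of_anti_or_down h10
    have Fanti := fill .anti (by simp) fun o i x y => by simp only [Kind.Req]; grind
    by_cases hdown : HasKind K .down
    · have sdown := fun o i x y => hdown.sepBy (o := o) (i := i) (x := x) (y := y)
      simp only [Kind.Sep] at sdown
      have Fdown := fill .down (by simp) fun o i x y => by simp only [Kind.Req]; grind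
      -- Likewise, the constant `0` lies below the minors of a function of kind `down`.
      refine Or.inr (Or.inr (Or.inl
        ⟨lowerPart k K, hne _ hdown, hK.isIdealLE_minMinC k fun g hg => ?_, ?_⟩))
      · by_cases hg0 : kind g = .const0
        · obtain ⟨f, hf, hfk⟩ := hdown
          obtain ⟨u, hu, ⟨hb, -⟩, hgu⟩ := hK.exists_majorant_of_const0 hf hg0
          exact ⟨u, hu, ⟨trivial, by rw [hb, kind_bot, hfk]; rfl⟩, hgu⟩
        · refine ⟨g, hg, (mem_at0_All_1_iff g).2 ?_, ⟨le_rfl⟩⟩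
          cases hκ : kind g <;> grind
      · by_cases h0 : HasKind K .const0
        · left
          ext f; rw [Set.mem_inter_iff, mem_Om_1_0_union_Const0_iff]
          cases hκ : kind f <;> grind
        · right
          ext f; rw [Set.mem_inter_iff, mem_Om_1_0_iff]
          cases hκ : kind f <;> grind
    · refine Or.inr (Or.inr (Or.inr (Or.inr (Or.inl
        ⟨lowerPart k K, hne _ (h10.resolve_right hdown), hself fun g hg => ?_, ?_⟩))))
      · rw [mem_negClass_Mon_iff]
        cases hκ : kind g <;> grind
      · by_cases h0 : HasKind K .const0
        · left
          ext f; rw [Set.mem_inter_iff, mem_negClass_at1_Mon_1_iff]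
          cases hκ : kind f <;> grind
        · right
          ext f; rw [Set.mem_inter_iff, mem_negClass_at01_Mon_0_1_iff]
          cases hκ : kind f <;> grind
  · have s00 := sepBy_of_refl0_or_eq0 h00
    have F0 := F0' h00
    have Frefl0 := fill .refl0 (by simp) fun o i x y => by simp only [Kind.Req]; grind
    by_cases heq0 : HasKind K .eq0
    · have seq0 := fun o i x y => heq0.sepBy (o := o) (i := i) (x := x) (y := y)
      simp only [Kind.Sep] at seq0
      have Feq0 := fill .eq0 (by simp) fun o i x y => by simp only [Kind.Req]; grind
      refine Or.inl (caseU fun f hf => ?_)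
      cases hκ : kind f <;> grind
    · refine Or.inr (Or.inr (Or.inr (Or.inr (Or.inr
        ⟨lowerPart k K, hne _ (h00.resolve_right heq0), hself fun g hg => ?_, ?_⟩))))
      · rw [mem_Refl_iff]
        cases hκ : kind g <;> grind
      · ext f; rw [Set.mem_inter_iff, mem_at01_Refl_0_0_iff]
        cases hκ : kind f <;> grind
  · -- Only constants `0` can be left, and possibly not even these.
    have Kc : ∀ g ∈ K, kind g = .const0 := by
      intro g hg
      cases hκ : kind g <;> grind
    refine Or.inl (caseU fun f hf => ?_)
    have hf0 : kind f = .const0 := by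
      by_contra hfk
      obtain ⟨a, ha⟩ := exists_true_of_kind hfk
      obtain ⟨g, hg, hga, -⟩ := hK.exists_mem_of_mem_UTheta hk hf a a
      exact absurd ((val_eq_of_kind_const0 (Kc _ hg) a).symm.trans (hga ha)) (by decide)
    obtain ⟨g, hg, -⟩ := hK.exists_mem_of_mem_UTheta hk hf ⊥ ⊥
    exact F0 ⟨_, hg, Kc _ hg⟩ f hf0

end NUMinions

open NUMinions in
theorem mainTheorem1 (k : ℕ) (hk : 2 ≤ k) (K : Set BoolFun) :
    IsClonoid Proj (MU01 k) K ↔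
      (∃ Θ : Set BoolFun, IsIdealLE k MinMin Θ ∧ K = UTheta k Θ) ∨
      (∃ Θ : Set BoolFun, Θ.Nonempty ∧ IsIdealLE k (MinMinC (at1 All true)) Θ ∧
        (K = UTheta k Θ ∩ (Om false true ∪ Const0) ∨ K = UTheta k Θ ∩ Om false true)) ∨
      (∃ Θ : Set BoolFun, Θ.Nonempty ∧ IsIdealLE k (MinMinC (at0 All true)) Θ ∧
        (K = UTheta k Θ ∩ (Om true false ∪ Const0) ∨ K = UTheta k Θ ∩ Om true false)) ∨
      (∃ Θ : Set BoolFun, Θ.Nonempty ∧ IsIdealLE k (MinMinC Mon) Θ ∧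
        (K = UTheta k Θ ∩ at0 Mon false ∨ K = UTheta k Θ ∩ at01 Mon false true)) ∨
      (∃ Θ : Set BoolFun, Θ.Nonempty ∧ IsIdealLE k (MinMinC (negClass Mon)) Θ ∧
        (K = UTheta k Θ ∩ negClass (at1 Mon true) ∨
          K = UTheta k Θ ∩ negClass (at01 Mon false true))) ∨
      (∃ Θ : Set BoolFun, Θ.Nonempty ∧ IsIdealLE k (MinMinC Refl) Θ ∧
        K = UTheta k Θ ∩ at01 Refl false false) ∨
      K ∈ ({OmLe, OmGe, OmEq,
        at0 All false ∪ Const, at1 All false ∪ Const,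
        at0 All true ∪ Const, at1 All true ∪ Const,
        Om false false ∪ Const, Om false true ∪ Const, Om true false ∪ Const,
        Om true true ∪ Const,
        Om false true ∪ Const1, Om true false ∪ Const1,
        at0 All true, at1 All true,
        Om true true,
        Mon, at1 Mon true, negClass Mon, negClass (at0 Mon false),
        Refl, at01 Refl false false ∪ Const, at01 Refl true true ∪ Const,
        at01 Refl true true,
        Const, Const1} : Set (Set BoolFun)) := by
  constructor
  · intro hK
    by_cases h1 : ∃ g ∈ K, g.val ⊥ = true ∧ g.val ⊤ = true
    · rcases hK.eq_of_const1_mem (by omega) h1 with h | h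
      · obtain ⟨g, hg, hb, ht⟩ := h1
        exact Or.inl ⟨_, hK.isIdealLE_minMin k, h.trans
          (Set.eq_univ_of_forall (hK.mem_UTheta_of_const1 k hg hb ht)).symm⟩
      · iterate 6 apply Or.inr
        exact h
    · rcases hK.eq_of_const1_notMem hk h1 with h | h | h | h | h | h
      · exact Or.inl h
      · exact Or.inr (Or.inl h)
      · exact Or.inr (Or.inr (Or.inl h))
      · exact Or.inr (Or.inr (Or.inr (Or.inl h)))
      · exact Or.inr (Or.inr (Or.inr (Or.inr (Or.inl h))))
      · exact Or.inr (Or.inr (Or.inr (Or.inr (Or.inr (Or.inl h)))))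
  · have hU := isClonoid_UTheta k
    rintro (⟨Θ, -, rfl⟩ | ⟨Θ, -, -, rfl | rfl⟩ | ⟨Θ, -, -, rfl | rfl⟩ | ⟨Θ, -, -, rfl | rfl⟩ |
      ⟨Θ, -, -, rfl | rfl⟩ | ⟨Θ, -, -, rfl⟩ | h)
    · exact hU Θ
    · exact (hU Θ).inter (isClonoid_Om01_union_Const0 k)
    · exact (hU Θ).inter (isClonoid_Om k _ _)
    · exact (hU Θ).inter (isClonoid_Om10_union_Const0 k)
    · exact (hU Θ).inter (isClonoid_Om k _ _)
    · exact (hU Θ).inter ((isClonoid_Mon k).restrict_at0 _)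
    · exact (hU Θ).inter ((isClonoid_Mon k).restrict_at01 _ _)
    · exact (hU Θ).inter (isClonoid_negClass_at1 k _)
    · exact (hU Θ).inter (isClonoid_negClass_at01 k _ _)
    · exact (hU Θ).inter ((isClonoid_Refl k).restrict_at01 _ _)
    · simp only [Set.mem_insert_iff, Set.mem_singleton_iff] at h
      rcases h with rfl | rfl | rfl | rfl | rfl | rfl | rfl | rfl | rfl | rfl | rfl | rfl | rfl |
        rfl | rfl | rfl | rfl | rfl | rfl | rfl | rfl | rfl | rfl | rfl | rfl | rfl
      exacts [isClonoid_OmLe k, isClonoid_OmGe k, isClonoid_OmEq k, isClonoid_botLe k,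
        isClonoid_topLe k, isClonoid_leBot k, isClonoid_leTop k, isClonoid_Om00_union_Const k,
        isClonoid_Om01_union_Const k, isClonoid_Om10_union_Const k, isClonoid_Om11_union_Const k,
        isClonoid_Om01_union_Const1 k, isClonoid_Om10_union_Const1 k, isClonoid_at0_All k _,
        isClonoid_at1_All k _, isClonoid_Om k _ _, isClonoid_Mon k,
        (isClonoid_Mon k).restrict_at1 _, isClonoid_negClass_Mon k, isClonoid_negClass_at0 k _,
        isClonoid_Refl k, isClonoid_Refl00_union_Const k, isClonoid_Refl11_union_Const k,
        (isClonoid_Refl k).restrict_at01 _ _, isClonoid_Const k,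
        (isClonoid_Const k).restrict_at01 _ _]
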